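/- Let $\mathcal P$ be any combination (conjunction of an arbitrary subset) of the following group properties: amenable, elementary amenable, subexponentially amenable, torsion-free, locally indicable, orderable, right orderable. Then every countable group $A$ with the property $\mathcal P$ embeds in a countable simple group $H$ with the property $\mathcal P$. Here a group $G$ is *amenable* if there is a left-invariant mean on the bounded real functions on $G$. *Elementary amenable* groups form the smallest class of groups that contains all finite and all abelian groups and is closed under taking subgroups, quotients, extensions and directed unions; *subexponentially amenable* groups form the smallest class that contains all finitely generated groups of subexponential growth (that is, $\lim_{n\to\infty}\gamma(n)^{1/n}=1$, where $\gamma(n)$ is the number of elements of word length at most $n$ with respect to a finite generating set) and is closed under the same operations. $G$ is *locally indicable* if every nontrivial finitely generated subgroup of $G$ maps homomorphically onto $\mathbb Z$; *orderable* if $G$ has a linear order invariant under left and right multiplication; *right orderable* if $G$ has a linear order invariant under right multiplication. "Countable" means finite or countably infinite. -/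

import Mathlib

open Filter Topology

universe u

/-- `G` is amenable: there is a left-invariant mean on the space of bounded real functions on `G`,
i.e. a positive, normalised linear functional on `ℓ^∞(G)` that is invariant under left
translations. -/
def IsAmenableGroup (G : Type u) [Group G] : Prop :=
  ∃ m : lp (fun _ : G => ℝ) ⊤ →ₗ[ℝ] ℝ,
    (∀ f : lp (fun _ : G => ℝ) ⊤, (∀ x, 0 ≤ f x) → 0 ≤ m f) ∧
    (∀ f : lp (fun _ : G => ℝ) ⊤, (∀ x, f x = 1) → m f = 1) ∧
    (∀ (g : G) (f f' : lp (fun _ : G => ℝ) ⊤), (∀ x, f' x = f (g * x)) → m f' = m f)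

/-- The smallest class of groups that contains the class `B` and is closed under taking subgroups,
quotients, extensions and directed unions. (Isomorphic copies are covered by the first two
operations, which are phrased through injective and surjective homomorphisms.) -/
inductive AmenabilityClosure (B : (G : Type u) → [Group G] → Prop) :
    (G : Type u) → [Group G] → Prop
  | base (G : Type u) [Group G] : B G → AmenabilityClosure B G
  | subgroup (G K : Type u) [Group G] [Group K] (f : K →* G) :
      Function.Injective f → AmenabilityClosure B G → AmenabilityClosure B K
  | quotient (G Q : Type u) [Group G] [Group Q] (f : G →* Q) :
      Function.Surjective f → AmenabilityClosure B G → AmenabilityClosure B Q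
  | extension (G : Type u) [Group G] (N : Subgroup G) [N.Normal] :
      AmenabilityClosure B N → AmenabilityClosure B (G ⧸ N) → AmenabilityClosure B G
  | directedUnion (G : Type u) [Group G] (F : Set (Subgroup G)) :
      F.Nonempty → DirectedOn (· ≤ ·) F → (∀ g : G, ∃ K ∈ F, g ∈ K) →
      (∀ K ∈ F, AmenabilityClosure B K) → AmenabilityClosure B G

/-- Elementary amenable groups: the smallest class containing all finite and all abelian groups and
closed under subgroups, quotients, extensions and directed unions. -/
def IsElementaryAmenable (G : Type u) [Group G] : Prop :=
  AmenabilityClosure (fun (K : Type u) [Group K] => Finite K ∨ ∀ a b : K, a * b = b * a) G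

/-- The ball of radius `n` about `1` for the word length given by `S`: the elements which are
products of at most `n` elements of `S ∪ S⁻¹`. -/
def wordBall {G : Type u} [Group G] (S : Set G) (n : ℕ) : Set G :=
  {g | ∃ l : List G, l.length ≤ n ∧ (∀ x ∈ l, x ∈ S ∨ x⁻¹ ∈ S) ∧ l.prod = g}

/-- `G` is finitely generated and of subexponential growth: for a finite generating set, the
growth function `γ(n)` (the cardinality of the ball of radius `n`) satisfies `γ(n)^(1/n) → 1`. -/
def IsFGSubexponentialGrowth (G : Type u) [Group G] : Prop :=
  ∃ S : Finset G, Subgroup.closure (S : Set G) = ⊤ ∧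
    Tendsto (fun n : ℕ => ((wordBall (S : Set G) n).ncard : ℝ) ^ (1 / (n : ℝ))) atTop (𝓝 1)

/-- Subexponentially amenable groups: the smallest class containing all finitely generated groups
of subexponential growth and closed under subgroups, quotients, extensions and directed unions. -/
def IsSubexponentiallyAmenable (G : Type u) [Group G] : Prop :=
  AmenabilityClosure (fun (K : Type u) [Group K] => IsFGSubexponentialGrowth K) G

/-- No nontrivial element has finite order. (Mathlib's `IsMulTorsionFree` asks for uniqueness of
roots, which is strictly stronger for noncommutative groups.) -/
def IsTorsionFreeGroup (G : Type u) [Group G] : Prop :=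
  ∀ g : G, g ≠ 1 → ¬ IsOfFinOrder g

/-- Every nontrivial finitely generated subgroup maps homomorphically onto an infinite cyclic
group. -/
def IsLocallyIndicable (G : Type u) [Group G] : Prop :=
  ∀ K : Subgroup G, K.FG → K ≠ ⊥ → ∃ f : K →* Multiplicative ℤ, Function.Surjective f

/-- `G` has a linear order invariant under left and right multiplication. -/
def IsOrderableGroup (G : Type u) [Group G] : Prop :=
  ∃ _ : LinearOrder G, ∀ a b c : G, a ≤ b → c * a ≤ c * b ∧ a * c ≤ b * c

/-- `G` has a linear order invariant under right multiplication. -/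
def IsRightOrderableGroup (G : Type u) [Group G] : Prop :=
  ∃ _ : LinearOrder G, ∀ a b c : G, a ≤ b → a * c ≤ b * c

/-- The seven group properties that may be combined. -/
inductive GroupProperty
  | amenable
  | elementaryAmenable
  | subexponentiallyAmenable
  | torsionFree
  | locallyIndicable
  | orderable
  | rightOrderable

/-- The group `G` has the property. -/
def GroupProperty.Holds (p : GroupProperty) (G : Type u) [Group G] : Prop :=
  match p with
  | amenable => IsAmenableGroup G
  | elementaryAmenable => IsElementaryAmenable G
  | subexponentiallyAmenable => IsSubexponentiallyAmenable G
  | torsionFree => IsTorsionFreeGroup G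
  | locallyIndicable => IsLocallyIndicable G
  | orderable => IsOrderableGroup G
  | rightOrderable => IsRightOrderableGroup G

/-! The simple group is the union of a chain A = G₀ < G₁ < … of countable groups in which, for every
nontrivial g in Gₙ, any normal subgroup of Gₙ₊₁ containing g contains all of Gₙ. Such a union is
simple: a nontrivial element of a normal subgroup N and an arbitrary element both lie in some Gₙ,
and N ∩ Gₙ₊₁ then contains Gₙ.

One link G < L of the chain is made in two moves. By `exists_derived_embedding`, G embeds in the
derived subgroup of some K, generated by the step functions ℤ → G and the translation: the
commutator of a step function with the translation is a function supported at one point. By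
`exists_wreath_embedding`, K embeds in a group L generated by the wreath power of K over the ordered
set ℤ and the shift. There a nontrivial k at level 0 moves the support of level -1 off itself, so a
normal subgroup containing k contains every commutator of level -1, and by the shift every
commutator of level 0.

Both K and L are assembled from copies of the given group and ℤ by extensions, directed unions and
passage to subgroups. Every property in the list except orderability holds for ℤ and is inherited by
these operations (`IsTameClass`), so it passes to the limit. The construction never refers to the
properties, so one group H serves all combinations.

Orderability is not inherited by extensions and is treated through actions: K and L act on
lexicographically ordered sets, and each nontrivial element moves the points of a final segment of
its support in a single direction, which yields a bi-invariant order (`IsOrderableGroup.of_perm`).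
-/

/-! ### Invariant means and the permanence properties of amenability. -/

section Amenability

/-- A real function with bounded values. -/
def IsBoundedFun {α : Type*} (f : α → ℝ) : Prop := ∃ C, ∀ x, |f x| ≤ C

namespace IsBoundedFun

variable {α β : Type*} {f g : α → ℝ}

theorem add (hf : IsBoundedFun f) (hg : IsBoundedFun g) : IsBoundedFun (f + g) := by
  obtain ⟨C, hC⟩ := hf
  obtain ⟨D, hD⟩ := hg
  exact ⟨C + D, fun x => (abs_add_le _ _).trans (add_le_add (hC x) (hD x))⟩

theorem smul (c : ℝ) (hf : IsBoundedFun f) : IsBoundedFun (c • f) := by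
  obtain ⟨C, hC⟩ := hf
  refine ⟨|c| * C, fun x => ?_⟩
  rw [Pi.smul_apply, smul_eq_mul, abs_mul]
  exact mul_le_mul_of_nonneg_left (hC x) (abs_nonneg c)

theorem const (c : ℝ) : IsBoundedFun (fun _ : α => c) := ⟨|c|, fun _ => le_rfl⟩

theorem comp (hf : IsBoundedFun f) (φ : β → α) : IsBoundedFun (f ∘ φ) := by
  obtain ⟨C, hC⟩ := hf
  exact ⟨C, fun x => hC (φ x)⟩

theorem memℓp (hf : IsBoundedFun f) : Memℓp (E := fun _ : α => ℝ) f ⊤ := by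
  obtain ⟨C, hC⟩ := hf
  refine memℓp_infty_iff.2 ⟨C, ?_⟩
  rintro _ ⟨x, rfl⟩
  exact hC x

end IsBoundedFun

theorem lp.isBoundedFun {α : Type*} (f : lp (fun _ : α => ℝ) ⊤) : IsBoundedFun (f : α → ℝ) := by
  obtain ⟨C, hC⟩ := memℓp_infty_iff.1 (lp.memℓp f)
  exact ⟨C, fun x => hC ⟨x, rfl⟩⟩

/-- A mean on the bounded real functions on `α`, extended by arbitrary values to all functions. -/
structure IsMean {α : Type*} (m : (α → ℝ) → ℝ) : Prop where
  add : ∀ f g, IsBoundedFun f → IsBoundedFun g → m (f + g) = m f + m g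
  smul : ∀ (c : ℝ) f, IsBoundedFun f → m (c • f) = c * m f
  nonneg : ∀ f, IsBoundedFun f → (∀ x, 0 ≤ f x) → 0 ≤ m f
  one : m (fun _ => 1) = 1

namespace IsMean

variable {α β : Type*} {m : (α → ℝ) → ℝ}

theorem mono (hm : IsMean m) {f g : α → ℝ} (hf : IsBoundedFun f) (hg : IsBoundedFun g)
    (h : ∀ x, f x ≤ g x) : m f ≤ m g := by
  have h1 := hm.nonneg (g + (-1 : ℝ) • f) (hg.add (hf.smul _)) (fun x => by simpa using h x)
  rw [hm.add _ _ hg (hf.smul _), hm.smul _ _ hf] at h1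
  linarith

theorem const (hm : IsMean m) (c : ℝ) : m (fun _ => c) = c := by
  have := hm.smul c (fun _ => 1) (.const 1)
  rw [hm.one, mul_one] at this
  refine Eq.trans (congrArg m ?_) this
  ext x
  simp

theorem abs_le (hm : IsMean m) {f : α → ℝ} {C : ℝ} (h : ∀ x, |f x| ≤ C) : |m f| ≤ C := by
  have hf : IsBoundedFun f := ⟨C, h⟩
  refine _root_.abs_le.2 ⟨?_, ?_⟩
  · rw [← hm.const (-C)]
    exact hm.mono (.const _) hf fun x => (_root_.abs_le.1 (h x)).1
  · rw [← hm.const C]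
    exact hm.mono hf (.const _) fun x => (_root_.abs_le.1 (h x)).2

theorem map (hm : IsMean m) (φ : α → β) : IsMean (fun f : β → ℝ => m (f ∘ φ)) where
  add _ _ hf hg := hm.add _ _ (hf.comp φ) (hg.comp φ)
  smul c _ hf := hm.smul c _ (hf.comp φ)
  nonneg _ hf h := hm.nonneg _ (hf.comp φ) fun x => h (φ x)
  one := hm.one

theorem isBoundedFun_family {ι : Type*} {m : ι → (α → ℝ) → ℝ} (hm : ∀ i, IsMean (m i))
    {f : ι → α → ℝ} {C : ℝ} (hf : ∀ i x, |f i x| ≤ C) : IsBoundedFun (fun i => m i (f i)) :=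
  ⟨C, fun i => (hm i).abs_le (hf i)⟩

/-- Averaging a family of means by a mean. -/
theorem bind {ι : Type*} {M : (ι → ℝ) → ℝ} (hM : IsMean M) {m : ι → (α → ℝ) → ℝ}
    (hm : ∀ i, IsMean (m i)) : IsMean (fun f => M (fun i => m i f)) where
  add f g hf hg := by
    obtain ⟨C, hC⟩ := id hf
    obtain ⟨D, hD⟩ := id hg
    rw [← hM.add _ _ (isBoundedFun_family hm fun _ => hC) (isBoundedFun_family hm fun _ => hD)]
    congr 1
    ext i
    exact (hm i).add f g hf hg
  smul c f hf := by
    obtain ⟨C, hC⟩ := id hf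
    rw [← hM.smul _ _ (isBoundedFun_family hm fun _ => hC)]
    congr 1
    ext i
    exact (hm i).smul c f hf
  nonneg f hf h := by
    obtain ⟨C, hC⟩ := id hf
    exact hM.nonneg _ (isBoundedFun_family hm fun _ => hC) fun i => (hm i).nonneg f hf h
  one := by simp only [(hm _).one, hM.one]

end IsMean

theorem IsBoundedFun.exists_tendsto {ι : Type*} (U : Ultrafilter ι) {f : ι → ℝ}
    (hf : IsBoundedFun f) : ∃ a, Tendsto f U (𝓝 a) := by
  obtain ⟨C, hC⟩ := hf
  obtain ⟨a, -, ha⟩ := (isCompact_Icc (a := -C) (b := C)).ultrafilter_le_nhds (U.map f) (by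
    rw [Filter.le_principal_iff]
    exact Filter.mem_map.2 (Filter.univ_mem' fun x => abs_le.1 (hC x)))
  exact ⟨a, ha⟩

theorem IsBoundedFun.tendsto_limUnder {ι : Type*} (U : Ultrafilter ι) {f : ι → ℝ}
    (hf : IsBoundedFun f) : Tendsto f U (𝓝 (limUnder (U : Filter ι) f)) :=
  tendsto_nhds_limUnder (hf.exists_tendsto U)

/-- The limit along an ultrafilter is a mean. -/
theorem isMean_limUnder {ι : Type*} (U : Ultrafilter ι) :
    IsMean (fun f : ι → ℝ => limUnder (U : Filter ι) f) where
  add _ _ hf hg := ((hf.tendsto_limUnder U).add (hg.tendsto_limUnder U)).limUnder_eq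
  smul c _ hf := ((hf.tendsto_limUnder U).const_mul c).limUnder_eq
  nonneg _ hf h := ge_of_tendsto' (hf.tendsto_limUnder U) h
  one := tendsto_const_nhds.limUnder_eq

/-- Left invariance of a mean on a group. -/
def IsLeftInvariantMean {G : Type*} [Group G] (m : (G → ℝ) → ℝ) : Prop :=
  ∀ (g : G) (f : G → ℝ), IsBoundedFun f → m (fun x => f (g * x)) = m f

/-- Replaces functionals on ℓ^∞ by functions on all of `G → ℝ`, so that means can be pulled back,
averaged and passed to limits without carrying boundedness proofs in the type. -/
theorem isAmenableGroup_iff {G : Type u} [Group G] :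
    IsAmenableGroup G ↔ ∃ m : (G → ℝ) → ℝ, IsMean m ∧ IsLeftInvariantMean m := by
  classical
  constructor
  · rintro ⟨m, h0, h1, hi⟩
    -- The value 0 on unbounded functions is arbitrary; every axiom of `IsMean` only tests bounded
    -- functions.
    let m' : (G → ℝ) → ℝ := fun f => if h : IsBoundedFun f then m ⟨f, h.memℓp⟩ else 0
    have hm' : ∀ {f} (h : IsBoundedFun f), m' f = m ⟨f, h.memℓp⟩ := fun h => dif_pos h
    refine ⟨m', ⟨fun f g hf hg => ?_, fun c f hf => ?_, fun f hf h => ?_, ?_⟩, fun g f hf => ?_⟩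
    · rw [hm' hf, hm' hg, hm' (hf.add hg), ← map_add]
      rfl
    · rw [hm' hf, hm' (hf.smul c), ← smul_eq_mul, ← map_smul]
      rfl
    · rw [hm' hf]
      exact h0 _ h
    · rw [hm' (.const 1)]
      exact h1 _ fun _ => rfl
    · exact (hm' (hf.comp (g * ·))).trans ((hi g _ _ fun _ => rfl).trans (hm' hf).symm)
  · rintro ⟨m, hm, hi⟩
    refine ⟨⟨⟨fun f => m f, fun f g => ?_⟩, fun c f => ?_⟩, fun f h => ?_, fun f h => ?_,
      fun g f f' h => ?_⟩
    · exact hm.add _ _ (lp.isBoundedFun f) (lp.isBoundedFun g)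
    · exact hm.smul _ _ (lp.isBoundedFun f)
    · exact hm.nonneg _ (lp.isBoundedFun f) h
    · exact (congrArg m (funext h)).trans hm.one
    · exact (congrArg m (funext h)).trans (hi g _ (lp.isBoundedFun f))

/-- A choice of representatives for the right cosets of the image gives a K-equivariant map `p : G →
K`; the pushforward of an invariant mean along it is invariant. -/
theorem IsAmenableGroup.of_injective {G K : Type u} [Group G] [Group K] (f : K →* G)
    (hf : Function.Injective f) (h : IsAmenableGroup G) : IsAmenableGroup K := by
  rw [isAmenableGroup_iff] at h ⊢
  obtain ⟨m, hm, hi⟩ := h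
  let s := QuotientGroup.rightRel f.range
  let r : G → G := fun g => (Quotient.mk s g).out
  have hr : ∀ g, ∃ k, f k = g * (r g)⁻¹ := fun g => by
    have := QuotientGroup.rightRel_apply.1 (Quotient.exact (Quotient.out_eq (Quotient.mk s g)))
    exact this
  choose p hp using hr
  have hrk : ∀ k g, r (f k * g) = r g := fun k g => by
    have : Quotient.mk s (f k * g) = Quotient.mk s g := by
      refine Quotient.sound (QuotientGroup.rightRel_apply.2 ⟨k⁻¹, ?_⟩)
      simp
    simp only [r, this]
  have hpk : ∀ k g, p (f k * g) = k * p g := fun k g => hf (by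
    rw [map_mul, hp, hp, hrk, mul_assoc])
  refine ⟨_, hm.map p, fun k φ hφ => ?_⟩
  rw [← hi (f k) (φ ∘ p) (hφ.comp p)]
  congr 1
  ext g
  simp [hpk]

/-- Averages over each coset of the kernel, then over the quotient. By invariance on the kernel, the
average over a coset does not depend on the representative (`key`), so the arbitrary section `s`
does no harm. -/
theorem IsAmenableGroup.of_ker {G Q : Type u} [Group G] [Group Q] (f : G →* Q)
    (hf : Function.Surjective f) (hN : IsAmenableGroup f.ker) (hQ : IsAmenableGroup Q) :
    IsAmenableGroup G := by
  rw [isAmenableGroup_iff] at hN hQ ⊢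
  obtain ⟨m, hm, hi⟩ := hN
  obtain ⟨M, hM, hI⟩ := hQ
  obtain ⟨s, hs⟩ := hf.hasRightInverse
  have key : ∀ (φ : G → ℝ), IsBoundedFun φ → ∀ a b : G, f a = f b →
      m (φ ∘ fun n : f.ker => a * n) = m (φ ∘ fun n : f.ker => b * n) := by
    intro φ hφ a b hab
    rw [← hi ⟨a⁻¹ * b, by simp [MonoidHom.mem_ker, hab]⟩ _ (hφ.comp _)]
    congr 1
    ext n
    simp [← mul_assoc]
  refine ⟨_, hM.bind fun q => hm.map fun n : f.ker => s q * n, fun g φ hφ => ?_⟩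
  obtain ⟨C, hC⟩ := id hφ
  rw [← hI (f g) (fun q => m (φ ∘ fun n : f.ker => s q * n))
    ⟨C, fun q => hm.abs_le fun n => hC _⟩]
  congr 1
  ext q
  rw [key φ hφ (s (f g * q)) (g * s q) (by rw [map_mul, hs, hs])]
  congr 1
  ext n
  simp [mul_assoc]

/-- An ultrafilter on a directed set of subgroups covering the group, containing all tails. -/
theorem exists_ultrafilter_of_directedOn {G : Type u} [Group G] {F : Set (Subgroup G)}
    (hne : F.Nonempty) (hdir : DirectedOn (· ≤ ·) F) (hcov : ∀ g : G, ∃ K ∈ F, g ∈ K) :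
    ∃ U : Ultrafilter F, ∀ g : G, ∀ᶠ K : F in U, g ∈ K.1 := by
  have : Nonempty F := hne.to_subtype
  have : IsDirected F (· ≤ ·) := ⟨fun a b => by
    obtain ⟨c, hc, h1, h2⟩ := hdir a a.2 b b.2
    exact ⟨⟨c, hc⟩, h1, h2⟩⟩
  obtain ⟨U, hU⟩ := Ultrafilter.exists_le (atTop : Filter F)
  refine ⟨U, fun g => hU ?_⟩
  obtain ⟨K, hK, hg⟩ := hcov g
  exact (eventually_ge_atTop (⟨K, hK⟩ : F)).mono fun L hL => hL hg

/-- The ultralimit of the means of the members is invariant, because a fixed `g` lies in almost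
every member. -/
theorem IsAmenableGroup.of_directedOn {G : Type u} [Group G] (F : Set (Subgroup G))
    (hne : F.Nonempty) (hdir : DirectedOn (· ≤ ·) F) (hcov : ∀ g : G, ∃ K ∈ F, g ∈ K)
    (h : ∀ K ∈ F, IsAmenableGroup K) : IsAmenableGroup G := by
  obtain ⟨U, hU⟩ := exists_ultrafilter_of_directedOn hne hdir hcov
  have h' : ∀ K : F, ∃ m : (K.1 → ℝ) → ℝ, IsMean m ∧ IsLeftInvariantMean m := fun K =>
    isAmenableGroup_iff.1 (h K.1 K.2)
  choose m hm hi using h'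
  rw [isAmenableGroup_iff]
  refine ⟨_, (isMean_limUnder U).bind fun K => (hm K).map fun k : K.1 => (k : G),
    fun g f hf => ?_⟩
  obtain ⟨C, hC⟩ := id hf
  have hb : IsBoundedFun (fun K : F => m K (f ∘ fun k : K.1 => (k : G))) :=
    ⟨C, fun K => (hm K).abs_le fun k => hC _⟩
  refine ((hb.tendsto_limUnder U).congr' ?_).limUnder_eq
  filter_upwards [hU g] with K hK
  exact (hi K ⟨g, hK⟩ _ (hf.comp _)).symm

theorem isMean_sum_range_div (n : ℕ) :
    IsMean (fun f : ℤ → ℝ => (∑ i ∈ Finset.range (n + 1), f i) / (n + 1)) where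
  add f g _ _ := by simp [Finset.sum_add_distrib, add_div]
  smul c f _ := by simp [← Finset.mul_sum, mul_div_assoc]
  nonneg f _ h := div_nonneg (Finset.sum_nonneg fun i _ => h i) (by positivity)
  one := by
    have : (n : ℝ) + 1 ≠ 0 := by positivity
    simp [this]

theorem isAmenableGroup_int : IsAmenableGroup (ULift.{u} (Multiplicative ℤ)) := by
  rw [isAmenableGroup_iff]
  let e : ℤ → ULift.{u} (Multiplicative ℤ) := fun n => ⟨Multiplicative.ofAdd n⟩
  obtain ⟨U, hU⟩ := Ultrafilter.exists_le (atTop : Filter ℕ)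
  have hM := (isMean_limUnder U).bind isMean_sum_range_div
  have hstep : ∀ f : ℤ → ℝ, IsBoundedFun f →
      limUnder (U : Filter ℕ) (fun n : ℕ => (∑ i ∈ Finset.range (n + 1), f (1 + i)) / (n + 1)) =
      limUnder (U : Filter ℕ) (fun n : ℕ => (∑ i ∈ Finset.range (n + 1), f i) / (n + 1)) := by
    intro f hf
    obtain ⟨C, hC⟩ := id hf
    have hb : IsBoundedFun
        (fun n : ℕ => (∑ i ∈ Finset.range (n + 1), f i) / ((n : ℝ) + 1)) :=
      ⟨C, fun n => (isMean_sum_range_div n).abs_le hC⟩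
    have h0 : Tendsto (fun n : ℕ => (2 * C) * (1 / ((n : ℝ) + 1))) atTop (𝓝 0) := by
      simpa using tendsto_one_div_add_atTop_nhds_zero_nat.const_mul (2 * C)
    -- Moving the window {0, …, n} by one changes the sum by f(n+1) − f(0), which is at most 2C in
    -- absolute value.
    have hd : Tendsto (fun n : ℕ => (f (n + 1) - f 0) / ((n : ℝ) + 1)) atTop (𝓝 0) := by
      refine squeeze_zero_norm (fun n => ?_) h0
      rw [Real.norm_eq_abs, abs_div, abs_of_pos (by positivity : (0 : ℝ) < n + 1), div_eq_mul_one_div]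
      refine mul_le_mul_of_nonneg_right ?_ (by positivity)
      have h1 := abs_le.1 (hC (n + 1))
      have h2 := abs_le.1 (hC 0)
      exact abs_le.2 ⟨by linarith, by linarith⟩
    have := (hb.tendsto_limUnder U).add (hd.mono_left hU)
    rw [add_zero] at this
    refine (this.congr fun n => ?_).limUnder_eq
    rw [← add_div]
    congr 1
    have h1 := Finset.sum_range_succ (fun i : ℕ => f i) (n + 1)
    have h2 := Finset.sum_range_succ' (fun i : ℕ => f i) (n + 1)
    have h3 : ∑ i ∈ Finset.range (n + 1), f (1 + i) = ∑ i ∈ Finset.range (n + 1), f ((i + 1 : ℕ)) :=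
      Finset.sum_congr rfl fun i _ => by push_cast; rw [add_comm]
    rw [h3]
    push_cast at h1 h2 ⊢
    linarith
  refine ⟨_, hM.map e, ?_⟩
  have hiter : ∀ (k : ℤ) (f : ULift.{u} (Multiplicative ℤ) → ℝ), IsBoundedFun f →
      limUnder (U : Filter ℕ)
        (fun n : ℕ => (∑ i ∈ Finset.range (n + 1), f (e k * e i)) / ((n : ℝ) + 1)) =
      limUnder (U : Filter ℕ) (fun n : ℕ => (∑ i ∈ Finset.range (n + 1), f (e i)) / ((n : ℝ) + 1)) := by
    intro k f hf
    have hadd : ∀ a b : ℤ, e a * e b = e (a + b) := fun _ _ => rfl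
    simp only [hadd]
    have hs : ∀ a : ℤ, limUnder (U : Filter ℕ)
          (fun n : ℕ => (∑ i ∈ Finset.range (n + 1), f (e (a + 1 + i))) / ((n : ℝ) + 1)) =
        limUnder (U : Filter ℕ)
          (fun n : ℕ => (∑ i ∈ Finset.range (n + 1), f (e (a + i))) / ((n : ℝ) + 1)) := fun a => by
      have := hstep (fun i => f (e (a + i))) (hf.comp _)
      simpa only [add_assoc] using this
    induction k with
    | zero => simp
    | succ i ih => rw [hs, ih]
    | pred i ih =>
      rw [← ih]
      have := hs (-i - 1)
      rw [sub_add_cancel] at this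
      exact this.symm
  exact fun g f hf => hiter (Multiplicative.toAdd g.down) f hf

end Amenability

/-! ### Classes closed under subgroups, extensions and directed unions; orderability criteria. -/

section TameClasses

theorem perm_apply_inv {X : Type*} (g : Equiv.Perm X) (x : X) : g (g⁻¹ x) = x :=
  g.apply_symm_apply x

theorem perm_inv_apply {X : Type*} (g : Equiv.Perm X) (x : X) : g⁻¹ (g x) = x :=
  g.symm_apply_apply x

/-- A class of groups which contains `ℤ` and is closed under subgroups, extensions and
directed unions. -/
structure IsTameClass (C : (G : Type u) → [Group G] → Prop) : Prop where
  of_injective : ∀ {G K : Type u} [Group G] [Group K] (f : K →* G),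
    Function.Injective f → C G → C K
  of_ker : ∀ {G Q : Type u} [Group G] [Group Q] (f : G →* Q),
    Function.Surjective f → C f.ker → C Q → C G
  of_directedOn : ∀ {G : Type u} [Group G] (F : Set (Subgroup G)), F.Nonempty →
    DirectedOn (· ≤ ·) F → (∀ g : G, ∃ K ∈ F, g ∈ K) → (∀ K ∈ F, C K) → C G
  int : C (ULift.{u} (Multiplicative ℤ))

theorem isTameClass_isAmenableGroup :
    IsTameClass (fun (G : Type u) [Group G] => IsAmenableGroup G) where
  of_injective f hf h := h.of_injective f hf
  of_ker f hf hN hQ := .of_ker f hf hN hQ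
  of_directedOn F hne hdir hcov h := .of_directedOn F hne hdir hcov h
  int := isAmenableGroup_int

/-- The only closure property not literally a constructor is the one for extensions: the quotient by
the kernel belongs to the class because it embeds in `Q` by the first isomorphism theorem. -/
theorem isTameClass_amenabilityClosure {B : (G : Type u) → [Group G] → Prop}
    (hB : B (ULift.{u} (Multiplicative ℤ))) :
    IsTameClass (fun (G : Type u) [Group G] => AmenabilityClosure B G) where
  of_injective f hf h := .subgroup _ _ f hf h
  of_ker f hf hN hQ := .extension _ f.ker hN
    (.subgroup _ _ (QuotientGroup.quotientKerEquivOfSurjective f hf).toMonoidHom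
      (QuotientGroup.quotientKerEquivOfSurjective f hf).injective hQ)
  of_directedOn F hne hdir hcov h := .directedUnion _ F hne hdir hcov h
  int := .base _ hB

theorem isTameClass_isElementaryAmenable :
    IsTameClass (fun (G : Type u) [Group G] => IsElementaryAmenable G) :=
  isTameClass_amenabilityClosure (Or.inr fun a b => mul_comm a b)

theorem ulift_int_prod_mem {l : List (ULift.{u} (Multiplicative ℤ))}
    (hl : ∀ x ∈ l, |Multiplicative.toAdd x.down| ≤ 1) :
    |Multiplicative.toAdd l.prod.down| ≤ l.length := by
  induction l with
  | nil => simp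
  | cons a l ih =>
    have h1 := hl a (by simp)
    have h2 := ih fun x hx => hl x (by simp [hx])
    rw [List.prod_cons, ULift.mul_down, toAdd_mul, List.length_cons]
    push_cast
    linarith [abs_add_le (Multiplicative.toAdd a.down) (Multiplicative.toAdd l.prod.down)]

theorem isFGSubexponentialGrowth_int :
    IsFGSubexponentialGrowth (ULift.{u} (Multiplicative ℤ)) := by
  let e : ℤ → ULift.{u} (Multiplicative ℤ) := fun n => ⟨Multiplicative.ofAdd n⟩
  let S : Finset (ULift.{u} (Multiplicative ℤ)) := {e 1}
  have hsub : ∀ n, wordBall (S : Set _) n ⊆ e '' (Finset.Icc (-(n : ℤ)) n : Finset ℤ) := by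
    rintro n _ ⟨l, hl, hS, rfl⟩
    refine ⟨Multiplicative.toAdd l.prod.down, ?_, rfl⟩
    have := ulift_int_prod_mem (l := l) (fun x hx => ?_)
    · rw [Finset.coe_Icc, Set.mem_Icc]
      exact abs_le.1 (this.trans (by exact_mod_cast hl))
    · rcases hS x hx with h | h
      · simp only [S, Finset.coe_singleton, Set.mem_singleton_iff] at h
        simp [h, e]
      · simp only [S, Finset.coe_singleton, Set.mem_singleton_iff] at h
        rw [← inv_inv x, h]
        simp [e]
  have hfin : ∀ n, (wordBall (S : Set _) n).Finite := fun n =>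
    ((Finset.finite_toSet _).image e).subset (hsub n)
  refine ⟨S, ?_, ?_⟩
  · rw [eq_top_iff]
    rintro ⟨n⟩ -
    rw [Finset.coe_singleton, Subgroup.mem_closure_singleton]
    exact ⟨Multiplicative.toAdd n, by ext; simp [e]⟩
  · have hlow : ∀ n, 1 ≤ (wordBall (S : Set (ULift.{u} (Multiplicative ℤ))) n).ncard := fun n => by
      have h1 : (1 : ULift.{u} (Multiplicative ℤ)) ∈ wordBall (S : Set _) n := ⟨[], by simp⟩
      exact (Set.ncard_pos (hfin n)).2 ⟨1, h1⟩
    have hup : ∀ n, (wordBall (S : Set (ULift.{u} (Multiplicative ℤ))) n).ncard ≤ 2 * n + 1 := fun n => by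
      refine (Set.ncard_le_ncard (hsub n) ((Finset.finite_toSet _).image e)).trans ?_
      refine (Set.ncard_image_le (Finset.finite_toSet _)).trans ?_
      rw [Set.ncard_coe_finset, Int.card_Icc]
      omega
    have hlim : Tendsto (fun n : ℕ => (2 * (n : ℝ) + 1) ^ (1 / (n : ℝ))) atTop (𝓝 1) := by
      -- At x = 2n + 1 the exponent 1 / (x/2 − 1/2) equals 1/n.
      have h1 := tendsto_rpow_div_mul_add 1 (1 / 2) (-(1 / 2)) (by norm_num)
      have h2 : Tendsto (fun n : ℕ => 2 * (n : ℝ) + 1) atTop atTop :=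
        tendsto_atTop_add_const_right _ _ (tendsto_natCast_atTop_atTop.const_mul_atTop two_pos)
      refine (h1.comp h2).congr fun n => ?_
      simp only [Function.comp]
      congr 2
      ring
    refine tendsto_of_tendsto_of_tendsto_of_le_of_le tendsto_const_nhds hlim (fun n => ?_)
      (fun n => ?_)
    · exact Real.one_le_rpow (by exact_mod_cast hlow n) (by positivity)
    · exact Real.rpow_le_rpow (by positivity) (by exact_mod_cast hup n) (by positivity)

theorem isTameClass_isSubexponentiallyAmenable :
    IsTameClass (fun (G : Type u) [Group G] => IsSubexponentiallyAmenable G) :=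
  isTameClass_amenabilityClosure isFGSubexponentialGrowth_int

theorem isTameClass_isTorsionFreeGroup :
    IsTameClass (fun (G : Type u) [Group G] => IsTorsionFreeGroup G) where
  of_injective f hf h g hg hfin :=
    h (f g) (fun h1 => hg (hf (h1.trans (map_one f).symm))) (f.isOfFinOrder hfin)
  of_ker f _ hN hQ g hg hfin := by
    by_cases h1 : f g = 1
    · exact hN ⟨g, h1⟩ (fun h => hg (congrArg Subtype.val h)) (Submonoid.isOfFinOrder_coe.1 hfin)
    · exact hQ _ h1 (f.isOfFinOrder hfin)
  of_directedOn F _ _ hcov h g hg hfin := by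
    obtain ⟨K, hK, hgK⟩ := hcov g
    exact h K hK ⟨g, hgK⟩ (fun h => hg (congrArg Subtype.val h)) (Submonoid.isOfFinOrder_coe.1 hfin)
  int g hg hfin := by
    obtain ⟨n, hn, h⟩ := isOfFinOrder_iff_pow_eq_one.1 hfin
    have h' : n * Multiplicative.toAdd g.down = 0 := by
      have := congrArg (fun x : ULift.{u} (Multiplicative ℤ) => Multiplicative.toAdd x.down) h
      simpa using this
    rcases mul_eq_zero.1 h' with h0 | h0
    · omega
    · exact hg (ULift.ext _ _ h0)

theorem IsLocallyIndicable.exists_surjective {G T : Type*} [Group G] [Group T] [Group.FG T]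
    [Nontrivial T] (h : IsLocallyIndicable G) (f : T →* G) (hf : Function.Injective f) :
    ∃ φ : T →* Multiplicative ℤ, Function.Surjective φ := by
  obtain ⟨φ, hφ⟩ := h f.range ((Group.fg_iff_subgroup_fg _).1 inferInstance) (fun hb => by
    obtain ⟨t, ht⟩ := exists_ne (1 : T)
    have : f t ∈ f.range := ⟨t, rfl⟩
    rw [hb, Subgroup.mem_bot] at this
    exact ht (hf (this.trans (map_one f).symm)))
  exact ⟨φ.comp f.rangeRestrict, hφ.comp f.rangeRestrict_surjective⟩

/-- The image is cyclic, generated by some d ≠ 0; dividing by d makes the homomorphism surjective.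
-/
theorem MonoidHom.exists_surjective_of_ne_one {T : Type*} [Group T] (f : T →* Multiplicative ℤ)
    (hf : f ≠ 1) : ∃ φ : T →* Multiplicative ℤ, Function.Surjective φ := by
  obtain ⟨d, hd⟩ := (Subgroup.isCyclic_iff_exists_zpowers_eq_top f.range).1 inferInstance
  have hd1 : Multiplicative.toAdd d ≠ 0 := by
    rintro h
    refine hf (MonoidHom.ext fun t => ?_)
    have : f t ∈ f.range := ⟨t, rfl⟩
    rw [← hd, show d = 1 from h] at this
    simpa using this
  have hdiv : ∀ t, ∃ k : ℤ, Multiplicative.toAdd (f t) = k * Multiplicative.toAdd d := fun t => by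
    have : f t ∈ f.range := ⟨t, rfl⟩
    rw [← hd, Subgroup.mem_zpowers_iff] at this
    obtain ⟨k, hk⟩ := this
    exact ⟨k, by rw [← hk]; simp⟩
  choose k hk using hdiv
  refine ⟨⟨⟨fun t => Multiplicative.ofAdd (k t), ?_⟩, fun a b => ?_⟩, fun n => ?_⟩
  · have := hk 1
    simpa [hd1] using this
  · have h := hk (a * b)
    rw [map_mul, toAdd_mul, hk a, hk b, ← add_mul] at h
    exact congrArg Multiplicative.ofAdd (mul_right_cancel₀ hd1 h.symm)
  · have : d ^ Multiplicative.toAdd n ∈ f.range := by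
      rw [← hd]
      exact ⟨_, rfl⟩
    obtain ⟨t, ht⟩ := this
    refine ⟨t, ?_⟩
    have h := hk t
    rw [ht, toAdd_zpow, smul_eq_mul] at h
    exact congrArg Multiplicative.ofAdd (mul_right_cancel₀ hd1 h).symm

/-- In an extension, a finitely generated subgroup either lies in the kernel or has a nontrivial
finitely generated image in the quotient. In a directed union it lies in a single member. -/
theorem isTameClass_isLocallyIndicable :
    IsTameClass (fun (G : Type u) [Group G] => IsLocallyIndicable G) where
  of_injective f hf h S hS hne := by
    have := (Group.fg_iff_subgroup_fg S).2 hS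
    have := (Subgroup.nontrivial_iff_ne_bot S).2 hne
    exact h.exists_surjective (f.comp S.subtype) (hf.comp S.subtype_injective)
  of_ker f _ hN hQ S hS hne := by
    have := (Group.fg_iff_subgroup_fg S).2 hS
    have := (Subgroup.nontrivial_iff_ne_bot S).2 hne
    by_cases h1 : ∀ s ∈ S, f s = 1
    · exact hN.exists_surjective (Subgroup.inclusion (show S ≤ f.ker from h1))
        (Subgroup.inclusion_injective _)
    · push Not at h1
      obtain ⟨s, hs, hfs⟩ := h1
      have : Nontrivial (f.comp S.subtype).range :=
        ⟨⟨⟨f s, ⟨s, hs⟩, rfl⟩, 1, fun h => hfs (congrArg Subtype.val h)⟩⟩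
      obtain ⟨φ, hφ⟩ := hQ.exists_surjective (f.comp S.subtype).range.subtype
        (Subgroup.subtype_injective _)
      exact ⟨φ.comp (f.comp S.subtype).rangeRestrict, hφ.comp (f.comp S.subtype).rangeRestrict_surjective⟩
  of_directedOn F hne hdir hcov h S hS hSne := by
    have : ∃ K ∈ F, S ≤ K := by
      obtain ⟨T, rfl⟩ := hS
      simp only [Subgroup.closure_le]
      clear hSne
      classical
      induction T using Finset.induction_on with
      | empty =>
        obtain ⟨K, hK⟩ := hne
        exact ⟨K, hK, by simp⟩
      | insert a T _ ih =>
        obtain ⟨K, hK, hT⟩ := ih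
        obtain ⟨L, hL, ha⟩ := hcov a
        obtain ⟨M, hM, h1, h2⟩ := hdir K hK L hL
        refine ⟨M, hM, ?_⟩
        rw [Finset.coe_insert]
        exact Set.insert_subset (h2 ha) (hT.trans h1)
    obtain ⟨K, hK, hSK⟩ := this
    have := (Group.fg_iff_subgroup_fg S).2 hS
    have := (Subgroup.nontrivial_iff_ne_bot S).2 hSne
    exact (h K hK).exists_surjective (Subgroup.inclusion hSK) (Subgroup.inclusion_injective _)
  int S hS hne := by
    refine MonoidHom.exists_surjective_of_ne_one
      ((MulEquiv.ulift (α := Multiplicative ℤ)).toMonoidHom.comp S.subtype) fun h => hne ?_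
    rw [Subgroup.eq_bot_iff_forall]
    exact fun x hx => MulEquiv.ulift.injective (DFunLike.congr_fun h ⟨x, hx⟩)

/-- The positive cone of a right-invariant order. -/
structure IsPositiveCone {G : Type*} [Group G] (P : Set G) : Prop where
  mul_mem : ∀ a b, a ∈ P → b ∈ P → a * b ∈ P
  one_notMem : 1 ∉ P
  mem_or : ∀ a, a ≠ 1 → a ∈ P ∨ a⁻¹ ∈ P

/-- The right-invariant linear order with a given positive cone. -/
@[reducible] noncomputable def IsPositiveCone.linearOrder {G : Type*} [Group G] {P : Set G}
    (hP : IsPositiveCone P) : LinearOrder G where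
  le a b := a = b ∨ b * a⁻¹ ∈ P
  le_refl a := Or.inl rfl
  le_trans a b c := by
    rintro (rfl | h1) (rfl | h2)
    · exact Or.inl rfl
    · exact Or.inr h2
    · exact Or.inr h1
    · exact Or.inr (by simpa using hP.mul_mem _ _ h2 h1)
  le_antisymm a b := by
    rintro (rfl | h1) (h | h2)
    · rfl
    · rfl
    · exact h.symm
    · exact absurd (by simpa using hP.mul_mem _ _ h2 h1) hP.one_notMem
  le_total a b := by
    by_cases h : a = b
    · exact Or.inl (Or.inl h)
    · rcases hP.mem_or (b * a⁻¹) (fun h' => h (mul_inv_eq_one.1 h').symm) with h1 | h1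
      · exact Or.inl (Or.inr h1)
      · exact Or.inr (Or.inr (by simpa using h1))
  toDecidableLE := Classical.decRel _

theorem isRightOrderableGroup_iff {G : Type u} [Group G] :
    IsRightOrderableGroup G ↔ ∃ P : Set G, IsPositiveCone P := by
  constructor
  · rintro ⟨o, h⟩
    refine ⟨{g | 1 < g}, fun a b ha hb => ?_, lt_irrefl 1, fun a ha => ?_⟩
    · have := h 1 a b (le_of_lt ha)
      rw [one_mul] at this
      exact lt_of_lt_of_le hb this
    · rcases lt_or_gt_of_ne ha with h1 | h1
      · refine Or.inr (lt_of_le_of_ne ?_ (Ne.symm (inv_ne_one.2 ha)))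
        simpa using h a 1 a⁻¹ h1.le
      · exact Or.inl h1
  · rintro ⟨P, hP⟩
    refine ⟨hP.linearOrder, fun a b c => ?_⟩
    rintro (rfl | h)
    · exact Or.inl rfl
    · exact Or.inr (by simpa [mul_assoc] using h)

theorem isOrderableGroup_iff {G : Type u} [Group G] :
    IsOrderableGroup G ↔
      ∃ P : Set G, IsPositiveCone P ∧ ∀ a c, a ∈ P → c * a * c⁻¹ ∈ P := by
  constructor
  · rintro ⟨o, h⟩
    refine ⟨{g | 1 < g}, ⟨fun a b ha hb => ?_, lt_irrefl 1, fun a ha => ?_⟩, fun a c ha => ?_⟩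
    · have := (h 1 a b (le_of_lt ha)).2
      rw [one_mul] at this
      exact lt_of_lt_of_le hb this
    · rcases lt_or_gt_of_ne ha with h1 | h1
      · refine Or.inr (lt_of_le_of_ne ?_ (Ne.symm (inv_ne_one.2 ha)))
        simpa using (h a 1 a⁻¹ h1.le).2
      · exact Or.inl h1
    · have h1 := (h _ _ c⁻¹ (h 1 a c (le_of_lt ha)).1).2
      rw [mul_one, mul_inv_cancel] at h1
      exact lt_of_le_of_ne h1 fun h2 => ne_of_gt ha (conj_eq_one_iff.1 h2.symm)
  · rintro ⟨P, hP, hc⟩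
    refine ⟨hP.linearOrder, fun a b c => ?_⟩
    rintro (rfl | h)
    · exact ⟨Or.inl rfl, Or.inl rfl⟩
    · exact ⟨Or.inr (by simpa [mul_assoc] using hc _ c h), Or.inr (by simpa [mul_assoc] using h)⟩

/-- Positive cones on the members of a directed family of subgroups have a limit. -/
theorem exists_isPositiveCone_of_directedOn {G : Type u} [Group G] {F : Set (Subgroup G)}
    (U : Ultrafilter F) (hU : ∀ g : G, ∀ᶠ K : F in U, g ∈ K.1) {P : ∀ K : F, Set K.1}
    (hP : ∀ K, IsPositiveCone (P K)) :
    IsPositiveCone {g : G | ∀ᶠ K : F in U, ∃ h : g ∈ K.1, ⟨g, h⟩ ∈ P K} where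
  mul_mem a b ha hb := by
    filter_upwards [ha, hb] with K ⟨h1, h2⟩ ⟨h3, h4⟩
    exact ⟨K.1.mul_mem h1 h3, (hP K).mul_mem _ _ h2 h4⟩
  one_notMem h := by
    obtain ⟨K, _, h2⟩ := h.exists
    exact (hP K).one_notMem h2
  mem_or a ha := by
    refine Ultrafilter.eventually_or.1 ?_
    filter_upwards [hU a] with K hK
    rcases (hP K).mem_or ⟨a, hK⟩ (fun h => ha (congrArg Subtype.val h)) with h | h
    · exact Or.inl ⟨hK, h⟩
    · exact Or.inr ⟨K.1.inv_mem hK, h⟩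

/-- For an extension the cone is lexicographic: the image in the quotient decides, and the kernel
breaks ties. Conjugation by G need not preserve the cone of the kernel, so the same argument fails
for two-sided orders. -/
theorem isTameClass_isRightOrderableGroup :
    IsTameClass (fun (G : Type u) [Group G] => IsRightOrderableGroup G) where
  of_injective f hf h := by
    obtain ⟨P, hP⟩ := isRightOrderableGroup_iff.1 h
    refine isRightOrderableGroup_iff.2 ⟨f ⁻¹' P, fun a b ha hb => ?_, fun h => ?_, fun a ha => ?_⟩
    · rw [Set.mem_preimage, map_mul]
      exact hP.mul_mem _ _ ha hb
    · rw [Set.mem_preimage, map_one] at h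
      exact hP.one_notMem h
    · rw [Set.mem_preimage, Set.mem_preimage, map_inv]
      exact hP.mem_or _ fun h => ha (hf (h.trans (map_one f).symm))
  of_ker f _ hN hQ := by
    obtain ⟨P, hP⟩ := isRightOrderableGroup_iff.1 hN
    obtain ⟨R, hR⟩ := isRightOrderableGroup_iff.1 hQ
    refine isRightOrderableGroup_iff.2
      ⟨{g | f g ∈ R ∨ ∃ h : g ∈ f.ker, ⟨g, h⟩ ∈ P}, fun a b ha hb => ?_, ?_, fun a ha => ?_⟩
    · rcases ha with ha | ⟨h1, ha⟩ <;> rcases hb with hb | ⟨h2, hb⟩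
      · exact Or.inl (by rw [map_mul]; exact hR.mul_mem _ _ ha hb)
      · exact Or.inl (by rw [map_mul, MonoidHom.mem_ker.1 h2, mul_one]; exact ha)
      · exact Or.inl (by rw [map_mul, MonoidHom.mem_ker.1 h1, one_mul]; exact hb)
      · exact Or.inr ⟨f.ker.mul_mem h1 h2, hP.mul_mem _ _ ha hb⟩
    · rintro (h | ⟨h1, h⟩)
      · rw [map_one] at h
        exact hR.one_notMem h
      · exact hP.one_notMem h
    · by_cases h : f a = 1
      · rcases hP.mem_or ⟨a, h⟩ (fun h' => ha (congrArg Subtype.val h')) with h' | h'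
        · exact Or.inl (Or.inr ⟨h, h'⟩)
        · exact Or.inr (Or.inr ⟨f.ker.inv_mem h, h'⟩)
      · rcases hR.mem_or _ h with h' | h'
        · exact Or.inl (Or.inl h')
        · exact Or.inr (Or.inl (by rwa [map_inv]))
  of_directedOn F hne hdir hcov h := by
    obtain ⟨U, hU⟩ := exists_ultrafilter_of_directedOn hne hdir hcov
    have h' : ∀ K : F, ∃ P : Set K.1, IsPositiveCone P := fun K =>
      isRightOrderableGroup_iff.1 (h K.1 K.2)
    choose P hP using h'
    exact isRightOrderableGroup_iff.2 ⟨_, exists_isPositiveCone_of_directedOn U hU hP⟩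
  int := ⟨LinearOrder.lift' (fun x => Multiplicative.toAdd x.down)
    (fun _ _ h => ULift.ext _ _ h), fun a b c h =>
      add_le_add_left (α := ℤ) h (Multiplicative.toAdd c.down)⟩

theorem IsOrderableGroup.of_injective {G K : Type u} [Group G] [Group K] (f : K →* G)
    (hf : Function.Injective f) (h : IsOrderableGroup G) : IsOrderableGroup K := by
  obtain ⟨o, h⟩ := h
  refine ⟨LinearOrder.lift' f hf, fun a b c hab => ?_⟩
  change f (c * a) ≤ f (c * b) ∧ f (a * c) ≤ f (b * c)
  simp only [map_mul]
  exact h _ _ _ hab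

theorem IsOrderableGroup.of_directedOn {G : Type u} [Group G] (F : Set (Subgroup G))
    (hne : F.Nonempty) (hdir : DirectedOn (· ≤ ·) F) (hcov : ∀ g : G, ∃ K ∈ F, g ∈ K)
    (h : ∀ K ∈ F, IsOrderableGroup K) : IsOrderableGroup G := by
  obtain ⟨U, hU⟩ := exists_ultrafilter_of_directedOn hne hdir hcov
  have h' : ∀ K : F, ∃ P : Set K.1, IsPositiveCone P ∧ ∀ a c, a ∈ P → c * a * c⁻¹ ∈ P := fun K =>
    isOrderableGroup_iff.1 (h K.1 K.2)
  choose P hP hc using h'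
  refine isOrderableGroup_iff.2
    ⟨_, exists_isPositiveCone_of_directedOn U hU hP, fun a c ha => ?_⟩
  filter_upwards [ha, hU c] with K ⟨h1, h2⟩ h3
  exact ⟨K.1.mul_mem (K.1.mul_mem h3 h1) (K.1.inv_mem h3), hc K _ ⟨c, h3⟩ h2⟩

/-- A group of automorphisms of a linear order is orderable if each nontrivial element moves the
points of a final segment of its support in one direction. -/
theorem IsOrderableGroup.of_perm {X : Type*} [LinearOrder X] (L : Subgroup (Equiv.Perm X))
    (hmono : ∀ g ∈ L, StrictMono g)
    (h : ∀ g ∈ L, g ≠ 1 → (∃ x, x < g x ∧ ∀ y, x ≤ y → y ≤ g y) ∨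
      ∃ x, g x < x ∧ ∀ y, x ≤ y → g y ≤ y) : IsOrderableGroup L := by
  have hinv' : ∀ g : L, ∀ {x y}, x ≤ g.1⁻¹ y ↔ g.1 x ≤ y := fun g x y => by
    rw [← (hmono g.1 g.2).le_iff_le, perm_apply_inv]
  -- The positive elements are those that move some point x up and move no later point down. If x is
  -- such a witness for `a`, then `c x` is one for `c a c⁻¹`.
  refine isOrderableGroup_iff.2 ⟨{g | ∃ x, x < g.1 x ∧ ∀ y, x ≤ y → y ≤ g.1 y},
    ⟨?_, ?_, fun g hg => ?_⟩, ?_⟩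
  · rintro a b ⟨x, hx, hx'⟩ ⟨y, hy, hy'⟩
    refine ⟨max x y, ?_, fun z hz => ?_⟩
    · rw [Subgroup.coe_mul, Equiv.Perm.mul_apply]
      rcases le_total x y with h | h
      · rw [max_eq_right h]
        exact hy.trans_le (hx' _ (h.trans hy.le))
      · rw [max_eq_left h]
        exact hx.trans_le ((hmono _ a.2).monotone (hy' _ h))
    · have h1 := hy' z (le_of_max_le_right hz)
      exact h1.trans (hx' _ ((le_of_max_le_left hz).trans h1))
  · rintro ⟨x, hx, -⟩
    exact lt_irrefl x hx
  · rcases h g.1 g.2 (fun h => hg (Subtype.ext h)) with h | ⟨x, hx, hx'⟩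
    · exact Or.inl h
    · refine Or.inr ⟨x, ?_, fun y hy => ?_⟩
      · rw [Subgroup.coe_inv]
        exact lt_of_not_ge fun h => absurd hx (not_lt.2 (by
          rw [← (hmono _ g.2).le_iff_le, perm_apply_inv] at h
          exact h))
      · exact (hinv' g).2 (hx' y hy)
  · rintro a c ⟨x, hx, hx'⟩
    refine ⟨c.1 x, ?_, fun y hy => ?_⟩
    · simp only [Subgroup.coe_mul, Subgroup.coe_inv, Equiv.Perm.mul_apply, perm_inv_apply]
      exact hmono _ c.2 hx
    · have h1 := hx' _ ((hinv' c).2 hy)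
      have := (hmono _ c.2).monotone h1
      rw [perm_apply_inv] at this
      exact this

/-- The criterion for a strict order given only as a relation, the form in which the lexicographic
orders below arise. -/
theorem IsOrderableGroup.of_perm_rel {X : Type*} (r : X → X → Prop) (hirr : ∀ x, ¬ r x x)
    (htrans : ∀ x y z, r x y → r y z → r x z) (htri : ∀ x y, x ≠ y → r x y ∨ r y x)
    (L : Subgroup (Equiv.Perm X)) (hmono : ∀ g ∈ L, ∀ x y, r x y → r (g x) (g y))
    (h : ∀ g ∈ L, g ≠ 1 → (∃ x, r x (g x) ∧ ∀ y, r x y → g y = y ∨ r y (g y)) ∨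
      ∃ x, r (g x) x ∧ ∀ y, r x y → g y = y ∨ r (g y) y) : IsOrderableGroup L := by
  classical
  have : IsStrictTotalOrder X r :=
    { trichotomous := fun x y h1 h2 => by
        by_contra hne
        exact (htri x y hne).elim h1 h2
      irrefl := hirr
      trans := htrans }
  let _ := linearOrderOfSTO r
  refine IsOrderableGroup.of_perm L (fun g hg x y hxy => hmono g hg x y hxy) fun g hg hg1 => ?_
  refine (h g hg hg1).imp (fun ⟨x, hx, hx'⟩ => ⟨x, hx, fun y hy => ?_⟩)
    fun ⟨x, hx, hx'⟩ => ⟨x, hx, fun y hy => ?_⟩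
  · rcases hy with rfl | hy
    · exact Or.inr hx
    · exact (hx' y hy).imp Eq.symm id
  · rcases hy with rfl | hy
    · exact Or.inr hx
    · exact hx' y hy

end TameClasses

/-! ### Wreath products realised by displaced permutation groups. -/

section Displacement

theorem Subgroup.countable_closure {G : Type*} [Group G] {s : Set G} (hs : s.Countable) :
    Countable (Subgroup.closure s) := by
  have := hs.to_subtype
  rw [FreeGroup.closure_eq_range]
  exact (FreeGroup.lift ((↑) : s → G)).rangeRestrict_surjective.countable

theorem Subgroup.exists_of_mem_sup_range {Ω S : Type*} [Group Ω] [Group S] {N : Subgroup Ω}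
    {φ : S →* Ω} (hnorm : ∀ s, ∀ n ∈ N, φ s * n * (φ s)⁻¹ ∈ N) {x : Ω} (hx : x ∈ N ⊔ φ.range) :
    ∃ n ∈ N, ∃ s, n * φ s = x := by
  have hle : φ.range ≤ normalizer N := by
    rw [Subgroup.le_normalizer_iff]
    rintro _ ⟨s, rfl⟩ n hn
    exact hnorm s n hn
  rw [← SetLike.mem_coe, Subgroup.coe_mul_of_right_le_normalizer_left N _ hle, Set.mem_mul] at hx
  obtain ⟨n, hn, _, ⟨s, rfl⟩, rfl⟩ := hx
  exact ⟨n, hn, s, rfl⟩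

namespace IsTameClass

variable {C : (G : Type u) → [Group G] → Prop} (hC : IsTameClass C)

include hC

theorem of_le {Ω : Type u} [Group Ω] {H K : Subgroup Ω} (h : H ≤ K) (hK : C K) : C H :=
  hC.of_injective (Subgroup.inclusion h) (Subgroup.inclusion_injective h) hK

theorem bot {Ω : Type u} [Group Ω] : C (⊥ : Subgroup Ω) :=
  hC.of_injective (1 : (⊥ : Subgroup Ω) →* _) (Function.injective_of_subsingleton _) hC.int

theorem map {Ω Ω' : Type u} [Group Ω] [Group Ω'] {H : Subgroup Ω} (f : Ω →* Ω')
    (hf : Function.Injective f) (h : C H) : C (H.map f) :=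
  hC.of_injective (H.equivMapOfInjective f hf).symm.toMonoidHom
    (H.equivMapOfInjective f hf).symm.injective h

theorem range {G Ω : Type u} [Group G] [Group Ω] (f : G →* Ω) (hf : Function.Injective f)
    (h : C G) : C f.range :=
  hC.of_injective (f.ofInjective hf).symm.toMonoidHom (f.ofInjective hf).symm.injective h

theorem of_directed {Ω : Type u} [Group Ω] {ι : Type*} [Nonempty ι] (K : ι → Subgroup Ω)
    (hdir : Directed (· ≤ ·) K) (h : ∀ i, C (K i)) {H : Subgroup Ω}
    (hH : ∀ g ∈ H, ∃ i, g ∈ K i) : C H := by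
  refine hC.of_directedOn (Set.range fun i => (K i).subgroupOf H) (Set.range_nonempty _) ?_ ?_ ?_
  · rintro _ ⟨i, rfl⟩ _ ⟨j, rfl⟩
    obtain ⟨k, hi, hj⟩ := hdir i j
    exact ⟨_, ⟨k, rfl⟩, Subgroup.comap_mono hi, Subgroup.comap_mono hj⟩
  · intro g
    obtain ⟨i, hi⟩ := hH g g.2
    exact ⟨_, ⟨i, rfl⟩, hi⟩
  · rintro _ ⟨i, rfl⟩
    exact hC.of_injective (H.subtype.subgroupComap (K i))
      (fun a b hab => Subtype.ext (Subtype.ext (congrArg (fun k : K i => (k : Ω)) hab))) (h i)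

/-- An internal semidirect product of groups in the class is in the class. -/
theorem sup_range {Ω S : Type u} [Group Ω] [Group S] (N : Subgroup Ω) (φ : S →* Ω)
    (hnorm : ∀ s, ∀ n ∈ N, φ s * n * (φ s)⁻¹ ∈ N) (hdisj : ∀ s, φ s ∈ N → s = 1)
    (hN : C N) (hS : C S) : C (N ⊔ φ.range : Subgroup Ω) := by
  let α : S →* MulAut N :=
    { toFun := fun s =>
        { toFun := fun n => ⟨φ s * n * (φ s)⁻¹, hnorm s n n.2⟩
          invFun := fun n => ⟨φ s⁻¹ * n * (φ s⁻¹)⁻¹, hnorm s⁻¹ n n.2⟩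
          left_inv := fun n => Subtype.ext (by simp [mul_assoc])
          right_inv := fun n => Subtype.ext (by simp [mul_assoc])
          map_mul' := fun a b => Subtype.ext (by simp [mul_assoc]) }
      map_one' := by ext n; simp
      map_mul' := fun a b => by ext n; simp [mul_assoc] }
  let F : N ⋊[α] S →* Ω := SemidirectProduct.lift N.subtype φ (fun s => by ext n; simp [α])
  have hF : ∀ x, F x = x.left * φ x.right := fun x => rfl
  have hinj : Function.Injective F := by
    refine (injective_iff_map_eq_one F).2 fun x hx => ?_
    rw [hF] at hx
    have h1 : x.right = 1 := hdisj _ (by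
      rw [← inv_eq_of_mul_eq_one_right hx]
      exact N.inv_mem x.left.2)
    rw [h1, map_one, mul_one] at hx
    exact SemidirectProduct.ext (Subtype.ext hx) h1
  have hCM : C (N ⋊[α] S) := by
    refine hC.of_ker SemidirectProduct.rightHom SemidirectProduct.rightHom_surjective ?_ hS
    rw [← SemidirectProduct.range_inl_eq_ker_rightHom]
    exact hC.range _ SemidirectProduct.inl_injective hN
  refine hC.of_le ?_ (hC.range F hinj hCM)
  refine sup_le (fun n hn => ⟨SemidirectProduct.inl ⟨n, hn⟩, ?_⟩) ?_
  · simp [F]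
  · rintro _ ⟨s, rfl⟩
    exact ⟨SemidirectProduct.inr s, by simp [F]⟩

end IsTameClass

/-- The conjugate `g B g⁻¹` of a subgroup. -/
def conjSubgroup {Ω : Type*} [Group Ω] (B : Subgroup Ω) (g : Ω) : Subgroup Ω :=
  B.map (MulAut.conj g).toMonoidHom

theorem mem_conjSubgroup {Ω : Type*} [Group Ω] {B : Subgroup Ω} {g x : Ω} :
    x ∈ conjSubgroup B g ↔ ∃ b ∈ B, g * b * g⁻¹ = x := by
  simp [conjSubgroup, Subgroup.mem_map]

/-- A group `B` of permutations supported in a nonempty set `D`, and a group `S` of permutations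
whose nontrivial elements displace `D`. -/
structure IsDisplacing {X S : Type*} [Group S] (B : Subgroup (Equiv.Perm X))
    (φ : S →* Equiv.Perm X) (D : Set X) : Prop where
  nonempty : D.Nonempty
  apply_eq : ∀ b ∈ B, ∀ x, x ∉ D → b x = x
  notMem : ∀ s, s ≠ 1 → ∀ x ∈ D, φ s x ∉ D

namespace IsDisplacing

variable {X S : Type*} [Group S] {B : Subgroup (Equiv.Perm X)} {φ : S →* Equiv.Perm X}
  {D : Set X} (h : IsDisplacing B φ D)

include h

theorem apply_mem {b : Equiv.Perm X} (hb : b ∈ B) {x : X} (hx : x ∈ D) : b x ∈ D := by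
  by_contra h1
  have h2 := b.injective (h.apply_eq b hb _ h1)
  exact h1 (h2.symm ▸ hx)

theorem conj_apply_of_ne {s s' : S} (hs : s ≠ s') {n : Equiv.Perm X}
    (hn : n ∈ conjSubgroup B (φ s)) {x : X} (hx : x ∈ D) : n (φ s' x) = φ s' x := by
  obtain ⟨b, hb, rfl⟩ := mem_conjSubgroup.1 hn
  have h1 := h.notMem (s⁻¹ * s') (fun h' => hs (inv_mul_eq_one.1 h')) x hx
  rw [map_mul, map_inv, Equiv.Perm.mul_apply] at h1
  rw [Equiv.Perm.mul_apply, Equiv.Perm.mul_apply, h.apply_eq b hb _ h1, perm_apply_inv]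

theorem conj_apply_of_forall {s : S} {n : Equiv.Perm X} (hn : n ∈ conjSubgroup B (φ s)) {x : X}
    (hx : ∀ d ∈ D, φ s d ≠ x) : n x = x := by
  obtain ⟨b, hb, rfl⟩ := mem_conjSubgroup.1 hn
  have h1 : (φ s)⁻¹ x ∉ D := fun h1 => hx _ h1 (perm_apply_inv _ _)
  rw [Equiv.Perm.mul_apply, Equiv.Perm.mul_apply, h.apply_eq b hb _ h1, perm_apply_inv]

theorem iSup_apply_of_forall {n : Equiv.Perm X} (hn : n ∈ ⨆ s, conjSubgroup B (φ s)) {x : X}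
    (hx : ∀ s, ∀ d ∈ D, φ s d ≠ x) : n x = x := by
  refine Subgroup.iSup_induction _ (C := fun n => n x = x) hn
    (fun s n hn => h.conj_apply_of_forall hn (hx s)) rfl fun a b ha hb => ?_
  rw [Equiv.Perm.mul_apply, hb, ha]

/-- On each translate of `D` an element of the base group acts through an element of `B`, which
is trivial for all but finitely many translates. -/
theorem exists_local {n : Equiv.Perm X} (hn : n ∈ ⨆ s, conjSubgroup B (φ s)) :
    ∃ β : S → B, (Function.mulSupport β).Finite ∧
      ∀ s, ∀ x ∈ D, n (φ s x) = φ s ((β s).1 x) := by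
  classical
  refine Subgroup.iSup_induction _ (C := fun n => ∃ β : S → B, (Function.mulSupport β).Finite ∧
    ∀ s, ∀ x ∈ D, n (φ s x) = φ s ((β s).1 x)) hn (fun s n hn => ?_)
    ⟨1, by simp, fun _ _ _ => rfl⟩ fun a b ha hb => ?_
  · obtain ⟨b, hb, hbn⟩ := mem_conjSubgroup.1 hn
    refine ⟨Pi.mulSingle s ⟨b, hb⟩, (Set.finite_singleton s).subset ?_, fun s' x hx => ?_⟩
    · exact Pi.mulSupport_mulSingle_subset
    · by_cases hs : s = s'
      · subst hs
        rw [Pi.mulSingle_eq_same, ← hbn]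
        simp
      · rw [h.conj_apply_of_ne hs hn hx, Pi.mulSingle_eq_of_ne (Ne.symm hs)]
        rfl
  · obtain ⟨β, hβ, hβ'⟩ := ha
    obtain ⟨γ, hγ, hγ'⟩ := hb
    refine ⟨β * γ, (hβ.union hγ).subset (Function.mulSupport_mul β γ), fun s x hx => ?_⟩
    rw [Equiv.Perm.mul_apply, hγ' s x hx, hβ' s _ (h.apply_mem (γ s).2 hx)]
    rfl

/-- The base group preserves the domain `D` itself, whereas a nontrivial `φ s` moves it off itself.
-/
theorem eq_one_of_mem_iSup {s : S} (hs : φ s ∈ ⨆ s, conjSubgroup B (φ s)) : s = 1 := by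
  obtain ⟨β, -, hβ⟩ := h.exists_local hs
  obtain ⟨x, hx⟩ := h.nonempty
  by_contra hne
  refine h.notMem s hne x hx ?_
  have := hβ 1 x hx
  rw [map_one, Equiv.Perm.one_apply, Equiv.Perm.one_apply] at this
  rw [this]
  exact h.apply_mem (β 1).2 hx

omit h in
theorem conj_mem_iSup (s : S) {n : Equiv.Perm X} (hn : n ∈ ⨆ s, conjSubgroup B (φ s)) :
    φ s * n * (φ s)⁻¹ ∈ ⨆ s, conjSubgroup B (φ s) := by
  refine Subgroup.iSup_induction _
    (C := fun n => φ s * n * (φ s)⁻¹ ∈ ⨆ s, conjSubgroup B (φ s)) hn (fun t n hn => ?_)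
    (by simp) fun a b ha hb => ?_
  · obtain ⟨b, hb, rfl⟩ := mem_conjSubgroup.1 hn
    exact Subgroup.mem_iSup_of_mem (s * t) (mem_conjSubgroup.2 ⟨b, hb, by simp [mul_assoc]⟩)
  · simpa [mul_assoc] using mul_mem ha hb

end IsDisplacing

/-- The conjugates act on disjoint translates of `D`, so they generate their restricted direct sum.
Finitely many of them are added one at a time as (trivial) semidirect products, and the whole is a
directed union. -/
theorem IsTameClass.iSup_conjSubgroup {C : (G : Type u) → [Group G] → Prop} (hC : IsTameClass C)
    {X S : Type u} [Group S] {B : Subgroup (Equiv.Perm X)} {φ : S →* Equiv.Perm X} {D : Set X}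
    (h : IsDisplacing B φ D) (hB : C B) :
    C (⨆ s, conjSubgroup B (φ s) : Subgroup (Equiv.Perm X)) := by
  classical
  have hconj : ∀ s, C (conjSubgroup B (φ s)) := fun s => 
    hC.map (MulAut.conj (φ s)).toMonoidHom (MulAut.conj (φ s)).injective hB
  have hfin : ∀ F : Finset S, C (⨆ s ∈ F, conjSubgroup B (φ s) : Subgroup (Equiv.Perm X)) := by
    intro F
    induction F using Finset.induction_on with
    | empty =>
      rw [show ⨆ s ∈ (∅ : Finset S), conjSubgroup B (φ s) = ⊥ by simp]
      exact hC.bot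
    | insert s F hs ih =>
      have hfix : ∀ n ∈ ⨆ s ∈ F, conjSubgroup B (φ s), ∀ x ∈ D, n (φ s x) = φ s x := by
        have : ⨆ s ∈ F, conjSubgroup B (φ s) ≤ fixingSubgroup (Equiv.Perm X) (φ s '' D) := by
          refine iSup₂_le fun t ht n hn => (mem_fixingSubgroup_iff _).2 ?_
          rintro _ ⟨x, hx, rfl⟩
          exact h.conj_apply_of_ne (ne_of_mem_of_not_mem ht hs) hn hx
        exact fun n hn x hx => (mem_fixingSubgroup_iff _).1 (this hn) _ ⟨x, hx, rfl⟩
      have hdis : ∀ m ∈ conjSubgroup B (φ s), ∀ n ∈ ⨆ s ∈ F, conjSubgroup B (φ s),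
          Equiv.Perm.Disjoint m n := fun m hm n hn x => by
        by_cases hx : ∃ d ∈ D, φ s d = x
        · obtain ⟨d, hd, rfl⟩ := hx
          exact Or.inr (hfix n hn d hd)
        · push Not at hx
          exact Or.inl (h.conj_apply_of_forall hm hx)
      have := hC.sup_range (⨆ s ∈ F, conjSubgroup B (φ s)) (conjSubgroup B (φ s)).subtype
        (fun m n hn => by
          rw [Subgroup.subtype_apply, (hdis m m.2 n hn).commute.eq, mul_inv_cancel_right]
          exact hn)
        (fun m hm => Subtype.ext (Equiv.Perm.ext fun x => (hdis m m.2 m hm x).elim id id))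
        ih (hconj s)
      rw [Finset.iSup_insert, sup_comm]
      rwa [Subgroup.range_subtype] at this
  refine hC.of_directed (fun F : Finset S => ⨆ s ∈ F, conjSubgroup B (φ s)) ?_ hfin ?_
  · exact Monotone.directed_le fun F F' hF => biSup_mono fun _ hs => Finset.mem_of_subset hF hs
  · intro g hg
    rw [iSup_eq_iSup_finset] at hg
    rwa [Subgroup.mem_iSup_of_directed] at hg
    exact Monotone.directed_le fun F F' hF => biSup_mono fun _ hs => Finset.mem_of_subset hF hs

end Displacement

/-! ### Embedding a group in a derived subgroup. -/

section DerivedEmbedding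

open scoped commutatorElement

variable {G : Type u} [Group G]

/-- The restricted power of `G`: the functions `ι → G` with finite support. -/
def restrictedPower (ι : Type*) (G : Type*) [Group G] : Subgroup (ι → G) where
  carrier := {f | (Function.mulSupport f).Finite}
  mul_mem' {f g} hf hg := (hf.union hg).subset (Function.mulSupport_mul f g)
  one_mem' := by simp
  inv_mem' {f} hf := by simpa [Function.mulSupport_inv] using hf

/-- A directed union of finite powers, and each finite power is an extension by evaluation at one
coordinate. -/
theorem IsTameClass.restrictedPower {C : (G : Type u) → [Group G] → Prop} (hC : IsTameClass C)
    {ι : Type} (hG : C G) : C (restrictedPower ι G) := by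
  classical
  let R : Finset ι → Subgroup (ι → G) := fun F =>
    { carrier := {f | Function.mulSupport f ⊆ F}
      mul_mem' := fun {f g} hf hg =>
        (Function.mulSupport_mul f g).trans (Set.union_subset hf hg)
      one_mem' := by simp
      inv_mem' := fun {f} hf => by simpa [Function.mulSupport_inv] using hf }
  have hR : ∀ F f, f ∈ R F ↔ ∀ i, i ∉ F → f i = 1 := fun F f => by
    change Function.mulSupport f ⊆ F ↔ _
    rw [Function.mulSupport_subset_iff']
    rfl
  refine hC.of_directed R ?_ (fun F => ?_) fun f hf => ?_
  · exact Monotone.directed_le fun F F' h f hf => Set.Subset.trans hf (Finset.coe_subset.2 h)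
  · induction F using Finset.induction_on with
    | empty =>
      refine hC.of_le (K := ⊥) (fun f hf => ?_) hC.bot
      exact funext fun i => (hR _ f).1 hf i (Finset.notMem_empty i)
    | insert a F ha ih =>
      let e : R (insert a F) →* G := (Pi.evalMonoidHom (fun _ : ι => G) a).comp (R (insert a F)).subtype
      refine hC.of_ker e (fun g => ?_) ?_ hG
      · refine ⟨⟨Pi.mulSingle a g, (hR _ _).2 fun i hi => ?_⟩, by simp [e]⟩
        have hia : i ≠ a := fun h => hi (by simp [h])
        exact Pi.mulSingle_eq_of_ne (M := fun _ : ι => G) hia g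
      · have hk : ∀ f : e.ker, f.1.1 ∈ R F := fun f => (hR _ _).2 fun i hi => by
          by_cases h : i = a
          · subst h
            exact f.2
          · exact (hR _ _).1 f.1.2 i (by simp [h, hi])
        exact hC.of_injective
          (((R (insert a F)).subtype.comp e.ker.subtype).codRestrict (R F) hk)
          (fun f g h => Subtype.ext (Subtype.ext (congrArg (fun x : R F => (x : ι → G)) h))) ih
  · have hf' : (Function.mulSupport f).Finite := hf
    exact ⟨hf'.toFinset, hf'.coe_toFinset.ge⟩

/-- The function `ℤ → G` with value `g` on the nonnegative integers and `1` elsewhere. -/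
def stepHom (G : Type*) [Group G] : G →* (ℤ → G) where
  toFun g n := if 0 ≤ n then g else 1
  map_one' := by ext; simp
  map_mul' a b := by ext n; by_cases h : 0 ≤ n <;> simp [h]

theorem stepHom_apply (g : G) (n : ℤ) : stepHom G g n = if 0 ≤ n then g else 1 := rfl

/-- The functions `ℤ → G` which are trivial near `-∞` and constant near `+∞`. -/
def eventuallyStep (G : Type*) [Group G] : Subgroup (ℤ → G) where
  carrier := {f | ∃ c, {n | f n ≠ stepHom G c n}.Finite}
  mul_mem' := by
    rintro f g ⟨c, hc⟩ ⟨d, hd⟩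
    refine ⟨c * d, (hc.union hd).subset fun n hn => ?_⟩
    by_contra h
    simp only [Set.mem_union, Set.mem_ofPred_eq, not_or, not_not] at h
    exact hn (by rw [map_mul, Pi.mul_apply, Pi.mul_apply, h.1, h.2])
  one_mem' := ⟨1, by simp⟩
  inv_mem' := by
    rintro f ⟨c, hc⟩
    refine ⟨c⁻¹, hc.subset fun n hn h => hn ?_⟩
    rw [map_inv, Pi.inv_apply, Pi.inv_apply, h]

theorem stepHom_mem_eventuallyStep (g : G) : stepHom G g ∈ eventuallyStep G := ⟨g, by simp⟩

/-- A step function and its translate by k can differ only between −|k| and |k|. -/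
theorem shift_mem_eventuallyStep (k : ℤ) {f : ℤ → G} (hf : f ∈ eventuallyStep G) :
    (fun n => f (n - k)) ∈ eventuallyStep G := by
  obtain ⟨c, hc⟩ := hf
  refine ⟨c, ((hc.preimage (sub_left_injective (b := k)).injOn).union
    (Set.finite_Icc (-|k|) |k|)).subset fun n hn => ?_⟩
  by_cases h : f (n - k) = stepHom G c (n - k)
  · refine Or.inr ?_
    replace hn : stepHom G c (n - k) ≠ stepHom G c n := h ▸ hn
    rw [stepHom_apply, stepHom_apply] at hn
    have h1 := le_abs_self k
    have h2 := neg_abs_le k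
    rw [Set.mem_Icc]
    split_ifs at hn <;> first | exact absurd rfl hn | constructor <;> omega
  · exact Or.inl h

/-- Dividing by the step function of the limit at +∞ leaves finite support, so the group is a
semidirect product of the restricted power with G. -/
theorem IsTameClass.eventuallyStep {C : (G : Type u) → [Group G] → Prop} (hC : IsTameClass C)
    (hG : C G) : C (eventuallyStep G) := by
  refine hC.of_le ?_ (hC.sup_range (_root_.restrictedPower ℤ G) (stepHom G) ?_ ?_
    (hC.restrictedPower hG) hG)
  · rintro f ⟨c, hc⟩
    rw [← inv_mul_cancel_right f (stepHom G c)]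
    refine mul_mem (Subgroup.mem_sup_left (hc.subset fun n hn h => hn ?_))
      (Subgroup.mem_sup_right ⟨c, rfl⟩)
    rw [Pi.mul_apply, Pi.inv_apply, h, mul_inv_cancel]
  · intro c f hf
    refine Set.Finite.subset hf fun n hn h => hn ?_
    rw [Pi.mul_apply, Pi.mul_apply, h, mul_one, Pi.inv_apply, mul_inv_cancel]
  · intro c hc
    by_contra hne
    refine (Set.Ici_infinite (0 : ℤ)).mono (fun n hn => ?_) hc
    rw [Function.mem_mulSupport, stepHom_apply, if_pos (Set.mem_Ici.1 hn)]
    exact hne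

/-- Translations of the first coordinate of `ℤ × G`. -/
def translation (G : Type u) : ULift.{u} (Multiplicative ℤ) →* Equiv.Perm (ℤ × G) where
  toFun k :=
    { toFun := fun x => (x.1 + Multiplicative.toAdd k.down, x.2)
      invFun := fun x => (x.1 - Multiplicative.toAdd k.down, x.2)
      left_inv := fun x => by simp
      right_inv := fun x => by simp }
  map_one' := by ext x <;> simp
  map_mul' a b := by ext x <;> simp [add_right_comm, ← add_assoc]

/-- Functions `ℤ → G` acting on the second coordinate of `ℤ × G` by left multiplication. -/
def fiberwise (G : Type u) [Group G] : (ℤ → G) →* Equiv.Perm (ℤ × G) where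
  toFun f :=
    { toFun := fun x => (x.1, f x.1 * x.2)
      invFun := fun x => (x.1, (f x.1)⁻¹ * x.2)
      left_inv := fun x => by simp
      right_inv := fun x => by simp }
  map_one' := by ext x <;> simp
  map_mul' a b := by ext x <;> simp [mul_assoc]

theorem translation_apply {G : Type u} (k : ULift.{u} (Multiplicative ℤ)) (x : ℤ × G) :
    translation G k x = (x.1 + Multiplicative.toAdd k.down, x.2) := rfl

theorem fiberwise_apply (f : ℤ → G) (x : ℤ × G) : fiberwise G f x = (x.1, f x.1 * x.2) := rfl

theorem fiberwise_injective : Function.Injective (fiberwise G) := fun f g h => by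
  ext n
  have := congrArg Prod.snd (DFunLike.congr_fun h (n, (1 : G)))
  simpa [fiberwise_apply] using this

theorem translation_conj_fiberwise (k : ULift.{u} (Multiplicative ℤ)) (f : ℤ → G) :
    translation G k * fiberwise G f * (translation G k)⁻¹ =
      fiberwise G (fun n => f (n - Multiplicative.toAdd k.down)) := by
  rw [mul_inv_eq_iff_eq_mul]
  ext x <;> simp [translation_apply, fiberwise_apply]

/-- A group of permutations of `ℤ × G` containing a copy of `G` in its derived subgroup. -/
def derivedHull (G : Type u) [Group G] : Subgroup (Equiv.Perm (ℤ × G)) :=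
  Subgroup.closure (Set.range (fun g => fiberwise G (stepHom G g)) ∪ Set.range (translation G))

theorem countable_derivedHull [Countable G] : Countable (derivedHull G) :=
  Subgroup.countable_closure ((Set.countable_range _).union (Set.countable_range _))

theorem translation_conj_mem (k : ULift.{u} (Multiplicative ℤ)) (n : Equiv.Perm (ℤ × G))
    (hn : n ∈ (eventuallyStep G).map (fiberwise G)) :
    translation G k * n * (translation G k)⁻¹ ∈ (eventuallyStep G).map (fiberwise G) := by
  obtain ⟨f, hf, rfl⟩ := hn
  rw [translation_conj_fiberwise]
  exact ⟨_, shift_mem_eventuallyStep _ hf, rfl⟩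

theorem derivedHull_le :
    derivedHull G ≤ (eventuallyStep G).map (fiberwise G) ⊔ (translation G).range := by
  refine (Subgroup.closure_le _).2 (Set.union_subset ?_ ?_)
  · rintro _ ⟨g, rfl⟩
    exact Subgroup.mem_sup_left ⟨_, stepHom_mem_eventuallyStep g, rfl⟩
  · rintro _ ⟨k, rfl⟩
    exact Subgroup.mem_sup_right ⟨k, rfl⟩

theorem exists_of_mem_derivedHull {g : Equiv.Perm (ℤ × G)} (hg : g ∈ derivedHull G) :
    ∃ f ∈ eventuallyStep G, ∃ k : ℤ, ∀ x, g x = (x.1 + k, f (x.1 + k) * x.2) := by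
  obtain ⟨_, ⟨f, hf, rfl⟩, k, rfl⟩ :=
    Subgroup.exists_of_mem_sup_range translation_conj_mem (derivedHull_le hg)
  exact ⟨f, hf, Multiplicative.toAdd k.down, fun x => rfl⟩

theorem IsTameClass.derivedHull {C : (G : Type u) → [Group G] → Prop} (hC : IsTameClass C)
    (hG : C G) : C (derivedHull G) := by
  refine hC.of_le derivedHull_le (hC.sup_range _ _ translation_conj_mem ?_
    (hC.map _ fiberwise_injective (hC.eventuallyStep hG)) hC.int)
  rintro k ⟨f, -, hf⟩
  have := congrArg Prod.fst (DFunLike.congr_fun hf (0, (1 : G)))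
  simp only [fiberwise_apply, translation_apply, zero_add] at this
  exact ULift.ext _ _ this.symm

/-- ℤ × G is ordered lexicographically, with ℤ dominant. A nonzero translation part moves every
point one way; otherwise the behaviour near +∞ is that of a single element of G. -/
theorem IsOrderableGroup.derivedHull (hG : IsOrderableGroup G) :
    IsOrderableGroup (derivedHull G) := by
  obtain ⟨o, ho⟩ := hG
  have hlt : ∀ c a b : G, a < b → c * a < c * b := fun c a b h =>
    lt_of_le_of_ne (ho a b c h.le).1 fun h' => h.ne (mul_left_cancel h')
  have hpos : ∀ c a : G, 1 < c → a < c * a := fun c a h => by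
    refine lt_of_le_of_ne ?_ fun h' => h.ne' (mul_eq_right.1 h'.symm)
    simpa using (ho 1 c a h.le).2
  have hneg : ∀ c a : G, c < 1 → c * a < a := fun c a h => by
    refine lt_of_le_of_ne ?_ fun h' => h.ne (mul_eq_right.1 h')
    simpa using (ho c 1 a h.le).2
  refine IsOrderableGroup.of_perm_rel (fun x y : ℤ × G => x.1 < y.1 ∨ x.1 = y.1 ∧ x.2 < y.2)
    (fun x h => ?_) (fun x y z h1 h2 => ?_) (fun x y hxy => ?_) (_root_.derivedHull G)
    (fun g hg x y hxy => ?_) fun g hg hg1 => ?_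
  · simp at h
  · rcases h1 with h1 | ⟨h1, h1'⟩ <;> rcases h2 with h2 | ⟨h2, h2'⟩
    · exact Or.inl (h1.trans h2)
    · exact Or.inl (h2 ▸ h1)
    · exact Or.inl (h1 ▸ h2)
    · exact Or.inr ⟨h1.trans h2, h1'.trans h2'⟩
  · rcases lt_trichotomy x.1 y.1 with h | h | h
    · exact Or.inl (Or.inl h)
    · rcases lt_or_gt_of_ne (fun h' => hxy (Prod.ext h h') : x.2 ≠ y.2) with h' | h'
      · exact Or.inl (Or.inr ⟨h, h'⟩)
      · exact Or.inr (Or.inr ⟨h.symm, h'⟩)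
    · exact Or.inr (Or.inl h)
  · obtain ⟨f, -, k, hk⟩ := exists_of_mem_derivedHull hg
    simp only [hk]
    rcases hxy with h | ⟨h, h'⟩
    · exact Or.inl (by linarith)
    · exact Or.inr ⟨by rw [h], by rw [h]; exact hlt _ _ _ h'⟩
  · obtain ⟨f, ⟨c, hc⟩, k, hk⟩ := exists_of_mem_derivedHull hg
    rcases lt_trichotomy k 0 with hk0 | rfl | hk0
    · exact Or.inr ⟨(0, 1), Or.inl (by rw [hk]; simpa using hk0),
        fun y _ => Or.inr (Or.inl (by rw [hk]; simpa using hk0))⟩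
    · simp only [add_zero] at hk
      -- If the limit c is trivial, m is the last index with a nontrivial value; otherwise m lies
      -- beyond all the exceptional indices, where f is constantly c.
      obtain ⟨m, hm, hm'⟩ : ∃ m, f m ≠ 1 ∧ ∀ n, m < n → f n = 1 ∨ f n = f m := by
        by_cases hc1 : c = 1
        · subst hc1
          have hne : ∃ m, f m ≠ 1 := by
            by_contra! h
            exact hg1 (Equiv.ext fun x => by rw [hk, h, one_mul]; rfl)
          simp only [map_one, Pi.one_apply] at hc
          obtain ⟨m, hm, hmax⟩ := hc.exists_maximal hne
          refine ⟨m, hm, fun n hn => Or.inl ?_⟩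
          by_contra h
          exact hn.not_ge (hmax h hn.le)
        · obtain ⟨b, hb⟩ := hc.bddAbove
          have hfm : ∀ n, max b 0 < n → f n = c := fun n hn => by
            by_contra h
            rw [max_lt_iff] at hn
            refine (hb (a := n) (fun h' => h ?_)).not_gt hn.1
            rw [h', stepHom_apply, if_pos hn.2.le]
          have h0 := hfm (max b 0 + 1) (lt_add_one _)
          exact ⟨max b 0 + 1, by rwa [h0], fun n hn => Or.inr (by
            rw [h0, hfm n ((lt_add_one _).trans hn)])⟩
      have hseg : ∀ y : ℤ × G, (m < y.1 ∨ m = y.1 ∧ 1 < y.2) → f y.1 = 1 ∨ f y.1 = f m := by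
        rintro y (h | ⟨h, -⟩)
        · exact hm' _ h
        · exact Or.inr (by rw [h])
      have hfix : ∀ y : ℤ × G, f y.1 = 1 → g y = y := fun y hy => by rw [hk, hy, one_mul]
      rcases lt_or_gt_of_ne hm with h1 | h1
      · refine Or.inr ⟨(m, 1), ?_, fun y hy => (hseg y hy).imp (hfix y) fun h => ?_⟩
        · rw [hk]
          exact Or.inr ⟨rfl, hneg _ _ h1⟩
        · rw [hk, h]
          exact Or.inr ⟨rfl, hneg _ _ h1⟩
      · refine Or.inl ⟨(m, 1), ?_, fun y hy => (hseg y hy).imp (hfix y) fun h => ?_⟩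
        · rw [hk]
          exact Or.inr ⟨rfl, hpos _ _ h1⟩
        · rw [hk, h]
          exact Or.inr ⟨rfl, hpos _ _ h1⟩
    · exact Or.inl ⟨(0, 1), Or.inl (by rw [hk]; simpa using hk0),
        fun y _ => Or.inr (Or.inl (by rw [hk]; simpa using hk0))⟩

/-- Every group embeds in the derived subgroup of a group that stays in every tame class and stays orderable. -/
theorem exists_derived_embedding (G : Type u) [Group G] [Countable G] :
    ∃ (K : Type u) (_ : Group K) (ι : G →* K), Countable K ∧ Nontrivial K ∧
      Function.Injective ι ∧ (∀ g, ι g ∈ commutator K) ∧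
      (∀ C : (G : Type u) → [Group G] → Prop, IsTameClass C → C G → C K) ∧
      (IsOrderableGroup G → IsOrderableGroup K) := by
  let τ : derivedHull G := ⟨translation G ⟨Multiplicative.ofAdd 1⟩,
    Subgroup.subset_closure (Or.inr ⟨_, rfl⟩)⟩
  let σ : G → derivedHull G := fun g => ⟨fiberwise G (stepHom G g),
    Subgroup.subset_closure (Or.inl ⟨g, rfl⟩)⟩
  -- The commutator is a step starting at 0 times the inverse of the step starting at 1; they cancel
  -- except at 0.
  have key : ∀ g, ((⁅σ g, τ⁆ : derivedHull G) : Equiv.Perm (ℤ × G)) =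
      fiberwise G (Pi.mulSingle 0 g) := fun g => by
    have h1 := translation_conj_fiberwise ⟨Multiplicative.ofAdd 1⟩ (stepHom G g)⁻¹
    rw [commutatorElement_def, mul_assoc, mul_assoc, ← mul_assoc τ]
    change fiberwise G (stepHom G g) * (translation G _ * (fiberwise G (stepHom G g))⁻¹ *
      (translation G _)⁻¹) = _
    rw [← map_inv, h1, ← map_mul]
    congr 1
    ext n
    simp only [Pi.mul_apply, Pi.inv_apply, stepHom_apply, toAdd_ofAdd]
    rcases lt_trichotomy n 0 with h | rfl | h
    · rw [if_neg (by omega), if_neg (by omega), Pi.mulSingle_eq_of_ne h.ne]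
      simp
    · simp
    · rw [if_pos (by omega), if_pos (by omega), Pi.mulSingle_eq_of_ne h.ne']
      simp
  let ι : G →* derivedHull G :=
    ((fiberwise G).comp (MonoidHom.mulSingle (fun _ : ℤ => G) 0)).codRestrict (derivedHull G)
      fun g => key g ▸ (⁅σ g, τ⁆ : derivedHull G).2
  refine ⟨derivedHull G, inferInstance, ι, countable_derivedHull, ⟨⟨τ, 1, fun h => ?_⟩⟩,
    fun a b hab => ?_, fun g => ?_, fun C hC h => hC.derivedHull h, fun h => h.derivedHull⟩
  · have := congrArg (fun x : derivedHull G => (x.1 (0, 1)).1) h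
    simp [τ, translation_apply] at this
  · have := fiberwise_injective (congrArg Subtype.val hab)
    exact Pi.mulSingle_injective 0 this
  · rw [show ι g = ⁅σ g, τ⁆ from Subtype.ext (key g).symm]
    exact Subgroup.commutator_mem_commutator (Subgroup.mem_top _) (Subgroup.mem_top _)

end DerivedEmbedding

/-! ### The wreath power over ℤ and its extension by the shift. -/

section WreathPower

open scoped commutatorElement

variable {K : Type u} [Group K]

/-- The functions `ℤ → K` which are trivial near `+∞`. -/
@[ext]
structure LowerSeq (K : Type u) [Group K] where
  /-- The underlying function. -/
  val : ℤ → K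
  exists_eq_one : ∃ n, ∀ m, n < m → val m = 1

namespace LowerSeq

/-- The sequences which are trivial above `n`. -/
def below (n : ℤ) : Set (LowerSeq K) := {x | ∀ m, n < m → x.1 m = 1}

instance : One (LowerSeq K) := ⟨⟨fun _ => 1, 0, fun _ _ => rfl⟩⟩

theorem one_mem_below (n : ℤ) : (1 : LowerSeq K) ∈ below n := fun _ _ => rfl

open Classical in
/-- Left multiplication of the `n`-th term of the sequences which are trivial above `n`. -/
noncomputable def mulAt (n : ℤ) (a : K) (x : LowerSeq K) : LowerSeq K :=
  ⟨fun m => if m = n ∧ x ∈ below n then a * x.1 m else x.1 m, by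
    obtain ⟨p, hp⟩ := x.2
    refine ⟨max p n, fun m hm => ?_⟩
    rw [max_lt_iff] at hm
    exact (if_neg fun h => hm.2.ne' h.1).trans (hp m hm.1)⟩

theorem mulAt_of_notMem {n : ℤ} {a : K} {x : LowerSeq K} (hx : x ∉ below n) : mulAt n a x = x :=
  LowerSeq.ext (funext fun _ => if_neg fun h => hx h.2)

theorem mulAt_of_ne {n m : ℤ} {a : K} {x : LowerSeq K} (h : m ≠ n) :
    (mulAt n a x).1 m = x.1 m := if_neg fun h' => h h'.1

theorem mulAt_same {n : ℤ} {a : K} {x : LowerSeq K} (hx : x ∈ below n) :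
    (mulAt n a x).1 n = a * x.1 n := if_pos ⟨rfl, hx⟩

theorem mulAt_mem_below {n : ℤ} {a : K} {x : LowerSeq K} :
    mulAt n a x ∈ below n ↔ x ∈ below n :=
  forall₂_congr fun m hm => by rw [mulAt_of_ne hm.ne']

theorem mulAt_one (n : ℤ) (x : LowerSeq K) : mulAt n 1 x = x :=
  LowerSeq.ext (funext fun m => by simp [mulAt])

theorem mulAt_mul (n : ℤ) (a b : K) (x : LowerSeq K) :
    mulAt n (a * b) x = mulAt n a (mulAt n b x) := by
  by_cases hx : x ∈ below n
  · refine LowerSeq.ext (funext fun m => ?_)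
    by_cases hm : m = n
    · subst hm
      rw [mulAt_same hx, mulAt_same (mulAt_mem_below.2 hx), mulAt_same hx, mul_assoc]
    · rw [mulAt_of_ne hm, mulAt_of_ne hm, mulAt_of_ne hm]
  · rw [mulAt_of_notMem hx, mulAt_of_notMem hx, mulAt_of_notMem hx]

/-- The action of `K` at level `n`. -/
noncomputable def level (n : ℤ) : K →* Equiv.Perm (LowerSeq K) where
  toFun a :=
    { toFun := mulAt n a
      invFun := mulAt n a⁻¹
      left_inv := fun x => by rw [← mulAt_mul, inv_mul_cancel, mulAt_one]
      right_inv := fun x => by rw [← mulAt_mul, mul_inv_cancel, mulAt_one] }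
  map_one' := Equiv.ext fun x => mulAt_one n x
  map_mul' a b := Equiv.ext fun x => mulAt_mul n a b x

theorem level_apply (n : ℤ) (a : K) (x : LowerSeq K) : level n a x = mulAt n a x := rfl

/-- Translations of the index. -/
def shift (K : Type u) [Group K] : ULift.{u} (Multiplicative ℤ) →* Equiv.Perm (LowerSeq K) where
  toFun k :=
    { toFun := fun x => ⟨fun m => x.1 (m - Multiplicative.toAdd k.down), by
        obtain ⟨n, hn⟩ := x.2
        exact ⟨n + Multiplicative.toAdd k.down, fun m hm => hn _ (by linarith)⟩⟩
      invFun := fun x => ⟨fun m => x.1 (m + Multiplicative.toAdd k.down), by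
        obtain ⟨n, hn⟩ := x.2
        exact ⟨n - Multiplicative.toAdd k.down, fun m hm => hn _ (by linarith)⟩⟩
      left_inv := fun x => LowerSeq.ext (funext fun m => by simp)
      right_inv := fun x => LowerSeq.ext (funext fun m => by simp) }
  map_one' := Equiv.ext fun x => LowerSeq.ext (funext fun m => congrArg x.1 (sub_zero m))
  map_mul' a b := Equiv.ext fun x => LowerSeq.ext (funext fun m => congrArg x.1 (by
    change m - (Multiplicative.toAdd a.down + Multiplicative.toAdd b.down) =
      m - Multiplicative.toAdd a.down - Multiplicative.toAdd b.down
    rw [sub_sub]))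

theorem shift_apply (k : ULift.{u} (Multiplicative ℤ)) (x : LowerSeq K) (m : ℤ) :
    (shift K k x).1 m = x.1 (m - Multiplicative.toAdd k.down) := rfl

theorem shift_mem_below {k : ULift.{u} (Multiplicative ℤ)} {x : LowerSeq K} {n : ℤ} :
    shift K k x ∈ below (n + Multiplicative.toAdd k.down) ↔ x ∈ below n := by
  refine ⟨fun h m hm => ?_, fun h m hm => h _ (by linarith)⟩
  have := h (m + Multiplicative.toAdd k.down) (by linarith)
  rwa [shift_apply, add_sub_cancel_right] at this

theorem shift_conj_level (k : ULift.{u} (Multiplicative ℤ)) (n : ℤ) (a : K) :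
    shift K k * level n a * (shift K k)⁻¹ = level (n + Multiplicative.toAdd k.down) a := by
  rw [mul_inv_eq_iff_eq_mul]
  refine Equiv.ext fun x => ?_
  rw [Equiv.Perm.mul_apply, Equiv.Perm.mul_apply, level_apply, level_apply]
  by_cases hx : x ∈ below n
  · refine LowerSeq.ext (funext fun m => ?_)
    rw [shift_apply]
    by_cases hm : m = n + Multiplicative.toAdd k.down
    · subst hm
      rw [mulAt_same (shift_mem_below.2 hx), shift_apply, add_sub_cancel_right, mulAt_same hx]
    · rw [mulAt_of_ne hm, shift_apply, mulAt_of_ne (fun h => hm (by linarith))]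
  · rw [mulAt_of_notMem hx, mulAt_of_notMem (fun h => hx (shift_mem_below.1 h))]

/-- This displacement makes level n act on the lower levels as the top group of a wreath product. -/
theorem level_notMem_below {n : ℤ} {a : K} (ha : a ≠ 1) {x : LowerSeq K} (hx : x ∈ below (n - 1)) :
    level n a x ∉ below (n - 1) := fun h => by
  have h1 := h n (by linarith)
  rw [level_apply, mulAt_same (fun m hm => hx m (by linarith)), hx n (by linarith), mul_one] at h1
  exact ha h1

/-- Every sequence trivial above `n` is a translate of one which is trivial above `n - 1`. -/
theorem exists_level_eq {n : ℤ} {x : LowerSeq K} (hx : x ∈ below n) :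
    ∃ d ∈ below (n - 1), level n (x.1 n) d = x := by
  refine ⟨level n (x.1 n)⁻¹ x, fun m hm => ?_, ?_⟩
  · rw [level_apply]
    rcases eq_or_lt_of_le (show n ≤ m by linarith [Int.sub_one_lt_iff.1 hm]) with rfl | h
    · rw [mulAt_same hx, inv_mul_cancel]
    · rw [mulAt_of_ne h.ne', hx m h]
  · rw [map_inv, perm_apply_inv]

/-- The iterated wreath product of `j` copies of `K` at the levels `n, n - 1, …, n - j + 1`. -/
noncomputable def tower (K : Type u) [Group K] : ℕ → ℤ → Subgroup (Equiv.Perm (LowerSeq K))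
  | 0, _ => ⊥
  | j + 1, n => (⨆ s, conjSubgroup (tower K j (n - 1)) (level n s)) ⊔ (level n).range

theorem isDisplacing_of_forall {n : ℤ} {B : Subgroup (Equiv.Perm (LowerSeq K))}
    (hB : ∀ b ∈ B, ∀ x, x ∉ below (n - 1) → b x = x) : IsDisplacing B (level n) (below (n - 1)) where
  nonempty := ⟨1, one_mem_below _⟩
  apply_eq := hB
  notMem _ hs _ hx := level_notMem_below hs hx

theorem exists_of_mem_tower {j : ℕ} {n : ℤ} {w : Equiv.Perm (LowerSeq K)}
    (hw : w ∈ tower K (j + 1) n) :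
    ∃ ν ∈ ⨆ s, conjSubgroup (tower K j (n - 1)) (level n s), ∃ s, ν * level n s = w :=
  Subgroup.exists_of_mem_sup_range (fun s _ hν => IsDisplacing.conj_mem_iSup s hν) hw

theorem level_mem_below_of_mem {n : ℤ} {s : K} {d : LowerSeq K} (hd : d ∈ below (n - 1)) :
    level n s d ∈ below n :=
  mulAt_mem_below.2 fun m hm => hd m (by linarith)

theorem tower_apply {j : ℕ} {n : ℤ} {w : Equiv.Perm (LowerSeq K)} (hw : w ∈ tower K j n)
    {x : LowerSeq K} (hx : x ∉ below n) : w x = x := by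
  induction j generalizing n w x with
  | zero =>
    rw [Subgroup.mem_bot.1 hw]
    rfl
  | succ j ih =>
    obtain ⟨ν, hν, s, rfl⟩ := exists_of_mem_tower hw
    rw [Equiv.Perm.mul_apply, level_apply, mulAt_of_notMem hx]
    refine (isDisplacing_of_forall fun b hb x hx => ih hb hx).iSup_apply_of_forall hν ?_
    rintro s d hd rfl
    exact hx (level_mem_below_of_mem hd)

theorem isDisplacing_tower (j : ℕ) (n : ℤ) :
    IsDisplacing (tower K j (n - 1)) (level n) (below (n - 1)) :=
  isDisplacing_of_forall fun _ hb _ hx => tower_apply hb hx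

/-- Each further level is an extension of K by a restricted direct sum of copies of the shorter
tower. -/
theorem _root_.IsTameClass.tower {C : (G : Type u) → [Group G] → Prop} (hC : IsTameClass C)
    (hK : C K) (j : ℕ) (n : ℤ) : C (tower K j n) := by
  induction j generalizing n with
  | zero => exact hC.bot
  | succ j ih =>
    exact hC.sup_range _ _ (fun s _ hν => IsDisplacing.conj_mem_iSup s hν)
      (fun s hs => (isDisplacing_tower j n).eq_one_of_mem_iSup hs)
      (hC.iSup_conjSubgroup (isDisplacing_tower j n) (ih (n - 1))) hK

theorem tower_le_succ_add (j : ℕ) (n : ℤ) : tower K j n ≤ tower K (j + 1) (n + 1) := by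
  intro w hw
  refine Subgroup.mem_sup_left (Subgroup.mem_iSup_of_mem 1 ?_)
  rw [add_sub_cancel_right]
  exact mem_conjSubgroup.2 ⟨w, hw, by simp⟩

theorem tower_le_succ (j : ℕ) (n : ℤ) : tower K j n ≤ tower K (j + 1) n := by
  induction j generalizing n with
  | zero => exact bot_le
  | succ j ih => exact sup_le_sup_right (iSup_mono fun s => Subgroup.map_mono (ih (n - 1))) _

/-- The i-th tower uses the levels i, …, −i + 1; it grows by one level at each end. -/
theorem directed_tower : Directed (· ≤ ·) fun i : ℕ => tower K (2 * i) i := by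
  refine (monotone_nat_of_le_succ fun i => ?_).directed_le
  have := (tower_le_succ (K := K) (2 * i) i).trans (tower_le_succ_add (2 * i + 1) i)
  exact_mod_cast this

theorem level_mem_tower {j l : ℕ} (h : l < j) (n : ℤ) (a : K) : level (n - l) a ∈ tower K j n := by
  induction j generalizing l n with
  | zero => omega
  | succ j ih =>
    cases l with
    | zero => exact Subgroup.mem_sup_right ⟨a, by simp⟩
    | succ l =>
      have := tower_le_succ_add _ _ (ih (Nat.lt_of_succ_lt_succ h) (n - 1))
      rwa [sub_add_cancel, show n - 1 - (l : ℤ) = n - ((l + 1 : ℕ) : ℤ) by push_cast; ring] at this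

/-- The wreath power of `K` over the ordered set `ℤ`. -/
noncomputable def wreathPower (K : Type u) [Group K] : Subgroup (Equiv.Perm (LowerSeq K)) :=
  ⨆ n, (level n).range

theorem exists_mem_tower {w : Equiv.Perm (LowerSeq K)} (hw : w ∈ wreathPower K) :
    ∃ i : ℕ, w ∈ tower K (2 * i) i := by
  rw [← Subgroup.mem_iSup_of_directed directed_tower]
  refine (iSup_le fun n => ?_ : wreathPower K ≤ _) hw
  rintro _ ⟨a, rfl⟩
  -- This tower covers the levels |n| + 1, …, −|n|, hence also n.
  refine Subgroup.mem_iSup_of_mem (n.natAbs + 1) ?_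
  have := level_mem_tower (j := 2 * (n.natAbs + 1)) (l := (n.natAbs + 1 - n).toNat) (by omega)
    ((n.natAbs + 1 : ℕ) : ℤ) a
  rwa [show ((n.natAbs + 1 : ℕ) : ℤ) - ((n.natAbs + 1 - n).toNat : ℤ) = n by omega] at this

theorem shift_conj_mem_wreathPower (k : ULift.{u} (Multiplicative ℤ))
    (w : Equiv.Perm (LowerSeq K)) (hw : w ∈ wreathPower K) :
    shift K k * w * (shift K k)⁻¹ ∈ wreathPower K := by
  refine Subgroup.iSup_induction _ (C := fun w => shift K k * w * (shift K k)⁻¹ ∈ wreathPower K) hw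
    ?_ (by simp) fun a b ha hb => by simpa [mul_assoc] using mul_mem ha hb
  rintro n _ ⟨a, rfl⟩
  rw [shift_conj_level]
  exact Subgroup.mem_iSup_of_mem _ ⟨a, rfl⟩

/-- The group generated by the wreath power of `K` over `ℤ` and the shift. -/
noncomputable def shiftHull (K : Type u) [Group K] : Subgroup (Equiv.Perm (LowerSeq K)) :=
  Subgroup.closure ((⋃ n, Set.range (level n)) ∪ Set.range (shift K))

theorem countable_shiftHull [Countable K] : Countable (shiftHull K) :=
  Subgroup.countable_closure
    ((Set.countable_iUnion fun _ => Set.countable_range _).union (Set.countable_range _))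

theorem level_mem_shiftHull (n : ℤ) (a : K) : level n a ∈ shiftHull K :=
  Subgroup.subset_closure (Or.inl (Set.mem_iUnion.2 ⟨n, a, rfl⟩))

theorem shift_mem_shiftHull (k : ULift.{u} (Multiplicative ℤ)) : shift K k ∈ shiftHull K :=
  Subgroup.subset_closure (Or.inr ⟨k, rfl⟩)

theorem shiftHull_le : shiftHull K ≤ wreathPower K ⊔ (shift K).range := by
  refine (Subgroup.closure_le _).2 (Set.union_subset (Set.iUnion_subset fun n => ?_) ?_)
  · rintro _ ⟨a, rfl⟩
    exact Subgroup.mem_sup_left (Subgroup.mem_iSup_of_mem n ⟨a, rfl⟩)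
  · rintro _ ⟨k, rfl⟩
    exact Subgroup.mem_sup_right ⟨k, rfl⟩

theorem exists_of_mem_shiftHull {g : Equiv.Perm (LowerSeq K)} (hg : g ∈ shiftHull K) :
    ∃ w ∈ wreathPower K, ∃ k, w * shift K k = g :=
  Subgroup.exists_of_mem_sup_range shift_conj_mem_wreathPower (shiftHull_le hg)

/-- The sequence with a single term `a` at the index `p`. -/
def single (p : ℤ) (a : K) : LowerSeq K :=
  ⟨Pi.mulSingle p a, p, fun _ hm => Pi.mulSingle_eq_of_ne (M := fun _ : ℤ => K) hm.ne' a⟩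

theorem single_same (p : ℤ) (a : K) : (single p a).1 p = a :=
  Pi.mulSingle_eq_same (M := fun _ : ℤ => K) p a

theorem single_of_ne {p m : ℤ} (h : m ≠ p) (a : K) : (single p a).1 m = 1 :=
  Pi.mulSingle_eq_of_ne (M := fun _ : ℤ => K) h a

theorem _root_.IsTameClass.shiftHull [Nontrivial K] {C : (G : Type u) → [Group G] → Prop}
    (hC : IsTameClass C) (hK : C K) : C (shiftHull K) := by
  refine hC.of_le shiftHull_le (hC.sup_range _ _ shift_conj_mem_wreathPower (fun k hk => ?_)
    (hC.of_directed _ directed_tower (fun i => hC.tower hK _ _) fun w => exists_mem_tower) hC.int)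
  obtain ⟨i, hi⟩ := exists_mem_tower hk
  obtain ⟨a, ha⟩ := exists_ne (1 : K)
  -- The tower fixes this sequence, since its top index is i + 1, whereas a nontrivial shift moves
  -- it. Hence the shift meets the wreath power trivially.
  have hx : single (i + 1 : ℤ) a ∉ below (i : ℤ) := fun h => ha (by
    rw [← h (i + 1) (lt_add_one _), single_same])
  have h1 := congrArg (fun x : LowerSeq K => x.1 (i + 1)) (tower_apply hi hx)
  simp only [shift_apply, single_same] at h1
  by_contra hne
  refine ha (h1.symm.trans (single_of_ne (fun h => hne ?_) a))
  exact ULift.ext _ _ (by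
    have : Multiplicative.toAdd k.down = 0 := by linarith
    exact this)

end LowerSeq

end WreathPower

/-! ### Orderability of the wreath power with shift. -/

section WreathPowerOrder

namespace LowerSeq

variable {K : Type u} [Group K] [LinearOrder K]

/-- The lexicographic order on sequences, in which the terms of higher index dominate. -/
def LexLt (x y : LowerSeq K) : Prop := ∃ n, x.1 n < y.1 n ∧ ∀ m, n < m → x.1 m = y.1 m

theorem LexLt.irrefl (x : LowerSeq K) : ¬ LexLt x x := fun ⟨_, h, _⟩ => lt_irrefl _ h

theorem LexLt.trans {x y z : LowerSeq K} (h1 : LexLt x y) (h2 : LexLt y z) : LexLt x z := by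
  obtain ⟨n, hn, hn'⟩ := h1
  obtain ⟨p, hp, hp'⟩ := h2
  rcases lt_trichotomy n p with h | rfl | h
  · exact ⟨p, (hn' p h).trans_lt hp, fun m hm => (hn' m (h.trans hm)).trans (hp' m hm)⟩
  · exact ⟨n, hn.trans hp, fun m hm => (hn' m hm).trans (hp' m hm)⟩
  · exact ⟨n, hn.trans_eq (hp' n h), fun m hm => (hn' m hm).trans (hp' m (h.trans hm))⟩

theorem LexLt.total {x y : LowerSeq K} (h : x ≠ y) : LexLt x y ∨ LexLt y x := by
  obtain ⟨a, ha⟩ := x.2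
  obtain ⟨b, hb⟩ := y.2
  have hne : ∃ n, x.1 n ≠ y.1 n := by
    by_contra! h'
    exact h (LowerSeq.ext (funext h'))
  have hbd : ∀ n, x.1 n ≠ y.1 n → n ≤ max a b := fun n hn => by
    by_contra h'
    rw [not_le, max_lt_iff] at h'
    exact hn ((ha n h'.1).trans (hb n h'.2).symm)
  obtain ⟨n, hn, hmax⟩ := Int.exists_greatest_of_bdd ⟨_, hbd⟩ hne
  have heq : ∀ m, n < m → x.1 m = y.1 m := fun m hm => by
    by_contra h'
    exact hm.not_ge (hmax m h')
  rcases lt_or_gt_of_ne hn with h' | h'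
  · exact Or.inl ⟨n, h', heq⟩
  · exact Or.inr ⟨n, h', fun m hm => (heq m hm).symm⟩

theorem LexLt.shift {x y : LowerSeq K} (h : LexLt x y) (k : ULift.{u} (Multiplicative ℤ)) :
    LexLt (shift K k x) (shift K k y) := by
  obtain ⟨n, hn, hn'⟩ := h
  refine ⟨n + Multiplicative.toAdd k.down, ?_, fun m hm => hn' _ (by linarith)⟩
  rwa [shift_apply, shift_apply, add_sub_cancel_right]

/-- The permutation `w` moves the points of a final segment of its support in the direction of
the relation `q`. -/
def MovesFinally (q : LowerSeq K → LowerSeq K → Prop) (w : Equiv.Perm (LowerSeq K)) : Prop :=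
  ∃ x, q x (w x) ∧ ∀ y, LexLt x y → w y = y ∨ q y (w y)

/-- A sequence whose last nontrivial term is at the index `p` and is positive. -/
def HasPositiveTop (p : ℤ) (x : LowerSeq K) : Prop := 1 < x.1 p ∧ x ∈ below p

theorem hasPositiveTop_single (p : ℤ) {a : K} (ha : 1 < a) : HasPositiveTop p (single p a) :=
  ⟨by rwa [single_same], fun _ hm => single_of_ne hm.ne' a⟩

theorem HasPositiveTop.of_lexLt {p : ℤ} {x y : LowerSeq K} (hx : HasPositiveTop p x)
    (h : LexLt x y) : ∃ q, p ≤ q ∧ HasPositiveTop q y := by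
  obtain ⟨n, hn, hn'⟩ := h
  have h2 := hx.2
  rcases lt_trichotomy n p with hnp | rfl | hnp
  · exact ⟨p, le_rfl, (hn' p hnp) ▸ hx.1, fun m hm => (hn' m (hnp.trans hm)) ▸ h2 m hm⟩
  · exact ⟨n, le_rfl, hx.1.trans hn, fun m hm => (hn' m hm) ▸ h2 m hm⟩
  · exact ⟨n, hnp.le, (h2 n hnp) ▸ hn, fun m hm => (hn' m hm) ▸ h2 m (hnp.trans hm)⟩

theorem HasPositiveTop.lexLt_shift {p : ℤ} {x : LowerSeq K} (hx : HasPositiveTop p x)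
    {k : ULift.{u} (Multiplicative ℤ)} (hk : 0 < Multiplicative.toAdd k.down) :
    LexLt x (LowerSeq.shift K k x) := by
  have h2 := hx.2
  refine ⟨p + Multiplicative.toAdd k.down, ?_, fun m hm => ?_⟩
  · rw [h2 _ (by linarith), shift_apply, add_sub_cancel_right]
    exact hx.1
  · rw [h2 _ (by linarith), shift_apply, h2 _ (by linarith)]

theorem HasPositiveTop.shift_lexLt {p : ℤ} {x : LowerSeq K} (hx : HasPositiveTop p x)
    {k : ULift.{u} (Multiplicative ℤ)} (hk : Multiplicative.toAdd k.down < 0) :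
    LexLt (LowerSeq.shift K k x) x := by
  have h2 := hx.2
  refine ⟨p, ?_, fun m hm => ?_⟩
  · rw [shift_apply, h2 _ (by linarith)]
    exact hx.1
  · rw [h2 m hm, shift_apply, h2 _ (by linarith)]

theorem HasPositiveTop.mul_shift_apply {j : ℕ} {n p : ℤ} {w : Equiv.Perm (LowerSeq K)}
    (hw : w ∈ tower K j n) {x : LowerSeq K} (hx : HasPositiveTop p x)
    {k : ULift.{u} (Multiplicative ℤ)} (hk : n < p + Multiplicative.toAdd k.down) :
    (w * LowerSeq.shift K k) x = LowerSeq.shift K k x := by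
  refine tower_apply hw fun h => ?_
  have := h _ hk
  rw [shift_apply, add_sub_cancel_right] at this
  exact hx.1.ne' this

/-- Far enough up, `w` acts trivially and only the shift is felt. Restricting to positive tops
matters because the shift moves negative tops the other way; these lie below the chosen point. -/
theorem movesFinally_mul_shift {j : ℕ} {n : ℤ} {w : Equiv.Perm (LowerSeq K)}
    (hw : w ∈ tower K j n) {k : ULift.{u} (Multiplicative ℤ)} {a : K} (ha : 1 < a)
    {q : LowerSeq K → LowerSeq K → Prop}
    (hq : ∀ (p : ℤ) (x : LowerSeq K), HasPositiveTop p x → q x (LowerSeq.shift K k x)) :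
    MovesFinally q (w * LowerSeq.shift K k) := by
  -- With this p, even after a shift by k the top index exceeds n.
  set p := n + |Multiplicative.toAdd k.down| + 1 with hp
  have hx := hasPositiveTop_single p ha
  have hk := neg_abs_le (Multiplicative.toAdd k.down)
  refine ⟨single p a, ?_, fun y hy => Or.inr ?_⟩
  · rw [hx.mul_shift_apply hw (by linarith)]
    exact hq _ _ hx
  · obtain ⟨r, hr, hy'⟩ := hx.of_lexLt hy
    rw [hy'.mul_shift_apply hw (by linarith)]
    exact hq _ _ hy'

/-- The base part ν preserves the n-th term, so on sequences trivial above n the product multiplies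
that dominant term by s; all of them move in the same direction. -/
theorem movesFinally_mul_level [MulRightStrictMono K] {j : ℕ} {n : ℤ} {ν : Equiv.Perm (LowerSeq K)}
    (hν : ν ∈ ⨆ s, conjSubgroup (tower K j (n - 1)) (level n s)) {s : K} (hs : s ≠ 1) :
    MovesFinally LexLt (ν * level n s) ∨ MovesFinally (flip LexLt) (ν * level n s) := by
  have hdisp := isDisplacing_tower (K := K) j n
  have hfix : ∀ x, x ∉ below n → (ν * level n s) x = x := fun x hx => by
    rw [Equiv.Perm.mul_apply, level_apply, mulAt_of_notMem hx]
    exact hdisp.iSup_apply_of_forall hν fun s d hd h => hx (h ▸ level_mem_below_of_mem hd)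
  obtain ⟨β, -, hβ⟩ := hdisp.exists_local hν
  have hmove : ∀ x ∈ below n, (ν * level n s) x ∈ below n ∧
      ((ν * level n s) x).1 n = s * x.1 n := fun x hx => by
    have hx' : level n s x ∈ below n := mulAt_mem_below.2 hx
    obtain ⟨d, hd, hdx⟩ := exists_level_eq hx'
    have hβd := hdisp.apply_mem (β ((level n s x).1 n)).2 hd
    rw [Equiv.Perm.mul_apply, ← hdx, hβ _ d hd]
    refine ⟨level_mem_below_of_mem hβd, ?_⟩
    rw [level_apply, mulAt_same fun m hm => hβd m (by linarith), hβd n (by linarith), mul_one,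
      level_apply, mulAt_same hx]
  rcases lt_or_gt_of_ne hs with h | h
  · have key : ∀ x ∈ below n, LexLt ((ν * level n s) x) x := fun x hx =>
      ⟨n, (hmove x hx).2 ▸ mul_lt_of_lt_one_left' _ h,
        fun m hm => ((hmove x hx).1 m hm).trans (hx m hm).symm⟩
    exact Or.inr ⟨1, key 1 (one_mem_below n), fun y _ => (em (y ∈ below n)).symm.imp
      (hfix y) (key y)⟩
  · have key : ∀ x ∈ below n, LexLt x ((ν * level n s) x) := fun x hx =>
      ⟨n, (hmove x hx).2 ▸ lt_mul_of_one_lt_left' _ h,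
        fun m hm => (hx m hm).trans ((hmove x hx).1 m hm).symm⟩
    exact Or.inl ⟨1, key 1 (one_mem_below n), fun y _ => (em (y ∈ below n)).symm.imp
      (hfix y) (key y)⟩

variable [MulLeftStrictMono K]

theorem LexLt.level {x y : LowerSeq K} (h : LexLt x y) (n : ℤ) (a : K) :
    LexLt (level n a x) (level n a y) := by
  obtain ⟨p, hp, hp'⟩ := h
  simp only [level_apply]
  rcases lt_or_ge n p with hnp | hnp
  · refine ⟨p, ?_, fun m hm => ?_⟩
    · rwa [mulAt_of_ne hnp.ne', mulAt_of_ne hnp.ne']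
    · rw [mulAt_of_ne (hnp.trans hm).ne', mulAt_of_ne (hnp.trans hm).ne', hp' m hm]
  · by_cases hx : x ∈ below n
    · have hy : y ∈ below n := fun m hm => (hp' m (hnp.trans_lt hm)) ▸ hx m hm
      refine ⟨p, ?_, fun m hm => ?_⟩
      · rcases eq_or_lt_of_le hnp with rfl | h
        · rw [mulAt_same hx, mulAt_same hy]
          exact mul_lt_mul_right hp a
        · rwa [mulAt_of_ne h.ne, mulAt_of_ne h.ne]
      · by_cases hmn : m = n
        · subst hmn
          rw [mulAt_same hx, mulAt_same hy, hp' m hm]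
        · rw [mulAt_of_ne hmn, mulAt_of_ne hmn, hp' m hm]
    · have hy : y ∉ below n := fun hy => hx fun m hm => (hp' m (hnp.trans_lt hm)).trans (hy m hm)
      rw [mulAt_of_notMem hx, mulAt_of_notMem hy]
      exact ⟨p, hp, hp'⟩

theorem LexLt.perm {x y : LowerSeq K} {g : Equiv.Perm (LowerSeq K)} (hg : g ∈ shiftHull K)
    (h : LexLt x y) : LexLt (g x) (g y) := by
  obtain ⟨w, hw, k, rfl⟩ := exists_of_mem_shiftHull hg
  have : ∀ x y, LexLt x y → LexLt (w x) (w y) := by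
    refine Subgroup.iSup_induction _ 
      (C := fun w : Equiv.Perm (LowerSeq K) => ∀ x y, LexLt x y → LexLt (w x) (w y)) hw ?_
      (fun _ _ h => h) fun a b ha hb x y h => ha (b x) (b y) (hb x y h)
    rintro n _ ⟨a, rfl⟩ x y h
    exact h.level n a
  exact this _ _ (h.shift k)

/-- A nontrivial element of the base group moves a final segment of its support as its
component at the largest index does. -/
theorem movesFinally_of_mem_iSup {j : ℕ} {n : ℤ} {ν : Equiv.Perm (LowerSeq K)}
    (hν : ν ∈ ⨆ s, conjSubgroup (tower K j (n - 1)) (level n s)) (hne : ν ≠ 1) :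
    ∃ b ∈ tower K j (n - 1), b ≠ 1 ∧ ∀ q : LowerSeq K → LowerSeq K → Prop,
      (∀ x, ¬ q x x) → (∀ x y (a : K), q x y → q (level n a x) (level n a y)) →
      MovesFinally q b → MovesFinally q ν := by
  have hdisp := isDisplacing_tower (K := K) j n
  obtain ⟨β, hβ, hβ'⟩ := hdisp.exists_local hν
  have hfix : ∀ x, x ∉ below n → ν x = x := fun x hx =>
    hdisp.iSup_apply_of_forall hν fun s d hd h => hx (h ▸ level_mem_below_of_mem hd)
  have hsupp : (Function.mulSupport β).Nonempty := by
    rw [Function.mulSupport_nonempty_iff]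
    rintro rfl
    refine hne (Equiv.ext fun x => ?_)
    by_cases hx : x ∈ below n
    · obtain ⟨d, hd, hdx⟩ := exists_level_eq hx
      have := hβ' (x.1 n) d hd
      rw [hdx] at this
      exact this.trans hdx
    · exact hfix x hx
  obtain ⟨s, hs, hmax⟩ := hβ.exists_maximal hsupp
  refine ⟨β s, (β s).2, fun h => hs (Subtype.ext h), fun q hirr hq ⟨d, hd, hd'⟩ => ?_⟩
  -- A point moved by an element of the tower lies in its support; irreflexivity of `q` is used
  -- here.
  have hdb : d ∈ below (n - 1) := by
    by_contra h
    rw [tower_apply (β s).2 h] at hd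
    exact hirr _ hd
  refine ⟨level n s d, ?_, fun y hy => ?_⟩
  · rw [hβ' s d hdb]
    exact hq _ _ _ hd
  · by_cases hyb : y ∈ below n
    · obtain ⟨e, he, hey⟩ := exists_level_eq hyb
      by_cases hys : y.1 n ∈ Function.mulSupport β
      · have hle : y.1 n ≤ s := (le_total (y.1 n) s).elim id fun h => hmax hys h
        have hge : s ≤ y.1 n := by
          have hxs : (level n s d).1 n = s := by
            rw [level_apply, mulAt_same fun m hm => hdb m (by linarith), hdb n (by linarith),
              mul_one]
          obtain ⟨p, hp, hp'⟩ := hy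
          rcases lt_trichotomy p n with h | rfl | h
          · exact (hxs.symm.trans (hp' n h)).le
          · exact (hxs.symm.trans_lt hp).le
          · rw [hyb p h, level_mem_below_of_mem hdb p h] at hp
            exact absurd hp (lt_irrefl _)
        have hseq := le_antisymm hle hge
        rw [hseq] at hey
        have hde : LexLt d e := by
          have := hy.level n s⁻¹
          rwa [← hey, map_inv, perm_inv_apply, perm_inv_apply] at this
        rw [← hey, hβ' s e he]
        exact (hd' e hde).imp (fun h => by rw [h]) (hq _ _ _)
      · left
        rw [Function.notMem_mulSupport] at hys
        have := hβ' (y.1 n) e he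
        rw [hys, hey] at this
        rw [this]
        exact hey
    · exact Or.inl (hfix y hyb)

variable [MulRightStrictMono K]

/-- Induction on the height: a nontrivial top component decides the direction, otherwise the
question passes to a component in a shorter tower. -/
theorem movesFinally_of_mem_tower {j : ℕ} {n : ℤ} {w : Equiv.Perm (LowerSeq K)}
    (hw : w ∈ tower K j n) (hne : w ≠ 1) :
    MovesFinally LexLt w ∨ MovesFinally (flip LexLt) w := by
  induction j generalizing n w with
  | zero => exact absurd (Subgroup.mem_bot.1 hw) hne
  | succ j ih =>
    obtain ⟨ν, hν, s, rfl⟩ := exists_of_mem_tower hw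
    by_cases hs : s = 1
    · subst hs
      rw [map_one, mul_one] at hne ⊢
      obtain ⟨b, hb, hb1, hb'⟩ := movesFinally_of_mem_iSup hν hne
      exact (ih hb hb1).imp (hb' _ LexLt.irrefl fun _ _ a h => h.level n a)
        (hb' _ LexLt.irrefl fun _ _ a h => LexLt.level h n a)
    · exact movesFinally_mul_level hν hs

end LowerSeq

open LowerSeq in
theorem IsOrderableGroup.shiftHull {K : Type u} [Group K] [Nontrivial K]
    (hK : IsOrderableGroup K) : IsOrderableGroup (LowerSeq.shiftHull K) := by
  obtain ⟨o, ho⟩ := hK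
  have : MulLeftStrictMono K := ⟨fun c a b h => lt_of_le_of_ne (ho a b c h.le).1
    fun h' => h.ne (mul_left_cancel h')⟩
  have : MulRightStrictMono K := ⟨fun c a b h => lt_of_le_of_ne (ho a b c h.le).2
    fun h' => h.ne (mul_right_cancel h')⟩
  obtain ⟨a, ha⟩ : ∃ a : K, 1 < a := by
    obtain ⟨a, ha⟩ := exists_ne (1 : K)
    rcases lt_or_gt_of_ne ha with h | h
    · exact ⟨a⁻¹, one_lt_inv_of_inv h⟩
    · exact ⟨a, h⟩
  refine IsOrderableGroup.of_perm_rel LexLt LexLt.irrefl (fun _ _ _ => LexLt.trans)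
    (fun _ _ => LexLt.total) _ (fun g hg x y => LexLt.perm hg) fun g hg hg1 => ?_
  obtain ⟨w, hw, k, rfl⟩ := exists_of_mem_shiftHull hg
  obtain ⟨i, hi⟩ := exists_mem_tower hw
  -- A nonzero shift dominates everything near the top; without it the element lies in a tower.
  rcases lt_trichotomy (Multiplicative.toAdd k.down) 0 with hk | hk | hk
  · exact Or.inr (movesFinally_mul_shift (q := flip LexLt) hi ha
      fun p x hx => hx.shift_lexLt hk)
  · obtain rfl : k = 1 := ULift.ext _ _ hk
    rw [map_one, mul_one] at hg1 ⊢
    exact movesFinally_of_mem_tower hi hg1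
  · exact Or.inl (movesFinally_mul_shift hi ha fun p x hx => hx.lexLt_shift hk)

end WreathPowerOrder

/-! ### Normal generation in the wreath power with shift. -/

section WreathEmbedding

open scoped commutatorElement

open LowerSeq

/-- In the group generated by the wreath power and the shift, every nontrivial element at a level
normally generates the derived subgroup of this level. -/
theorem exists_wreath_embedding (K : Type u) [Group K] [Countable K] [Nontrivial K] :
    ∃ (L : Type u) (_ : Group L) (ι : K →* L), Countable L ∧ Function.Injective ι ∧
      (∀ N : Subgroup L, N.Normal → ∀ k, k ≠ 1 → ι k ∈ N → ∀ c ∈ commutator K, ι c ∈ N) ∧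
      (∀ C : (G : Type u) → [Group G] → Prop, IsTameClass C → C K → C L) ∧
      (IsOrderableGroup K → IsOrderableGroup L) := by
  let ι : ℤ → K →* shiftHull K := fun n => (level n).codRestrict _ (level_mem_shiftHull n)
  let τ : shiftHull K := ⟨_, shift_mem_shiftHull ⟨Multiplicative.ofAdd 1⟩⟩
  have hτ : ∀ a, τ * ι (-1) a * τ⁻¹ = ι 0 a := fun a =>
    Subtype.ext (shift_conj_level ⟨Multiplicative.ofAdd 1⟩ (-1) a)
  refine ⟨shiftHull K, inferInstance, ι 0, countable_shiftHull, fun a b hab => ?_,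
    fun N hN k hk hkN => ?_, fun C hC h => hC.shiftHull h, fun h => h.shiftHull⟩
  · have h1 : level 0 a (1 : LowerSeq K) = level 0 b 1 :=
      DFunLike.congr_fun (congrArg Subtype.val hab) 1
    have h2 := congrArg (fun x : LowerSeq K => x.1 0) h1
    simp only [level_apply, mulAt_same (one_mem_below 0)] at h2
    exact mul_right_cancel h2
  -- Conjugation by k at level 0 carries the support of level -1 to a disjoint set.
  · have hcomm : ∀ a b, Commute (ι 0 k * ι (-1) a * (ι 0 k)⁻¹) (ι (-1) b) := fun a b => by
      refine Subtype.ext (Equiv.Perm.Disjoint.commute (f := level 0 k * level (-1) a *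
        (level 0 k)⁻¹) (g := level (-1) b) fun x => ?_)
      by_cases hx : x ∈ below (-1)
      · left
        have hx' : level 0 k⁻¹ x ∉ below (-1) :=
          level_notMem_below (n := 0) (inv_ne_one.2 hk) hx
        rw [← map_inv, Equiv.Perm.mul_apply, Equiv.Perm.mul_apply, level_apply (-1),
          mulAt_of_notMem hx', map_inv, perm_apply_inv]
      · exact Or.inr (mulAt_of_notMem hx)
    have hle : commutator K ≤ N.comap (ι 0) := by
      refine Subgroup.commutator_le.2 fun a _ b _ => ?_
      rw [Subgroup.mem_comap, ← hτ]
      refine hN.conj_mem _ ?_ τ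
      have h1 : ∀ a, ι (-1) a * ι 0 k * (ι (-1) a)⁻¹ * (ι 0 k)⁻¹ ∈ N := fun a =>
        mul_mem (hN.conj_mem _ hkN _) (inv_mem hkN)
      have h2 := hN.conj_mem _ (inv_mem (h1 a)) (ι (-1) b)
      have h3 := mul_mem (h1 a) h2
      convert h3 using 1
      have := (hcomm a b).eq
      rw [map_commutatorElement, commutatorElement_def]
      -- With a' = k a k⁻¹, which commutes with b, the commutator [[a, k], b] = [a a'⁻¹, b] reduces
      -- to [a, b].
      calc _ = ι (-1) a * (ι 0 k * ι (-1) a * (ι 0 k)⁻¹)⁻¹ *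
            ((ι 0 k * ι (-1) a * (ι 0 k)⁻¹) * ι (-1) b) * (ι (-1) a)⁻¹ * (ι (-1) b)⁻¹ := by group
        _ = _ := by rw [this]; group
    exact fun c hc => hle hc

end WreathEmbedding

/-! ### The chain of embeddings and its simple union. -/

section SimpleLimit

/-- The union of an increasing sequence of groups. -/
theorem exists_sequential_limit {G : ℕ → Type u} [∀ n, Group (G n)] (ι : ∀ n, G n →* G (n + 1))
    (hι : ∀ n, Function.Injective (ι n)) :
    ∃ (H : Type u) (_ : Group H) (φ : ∀ n, G n →* H), (∀ n, Function.Injective (φ n)) ∧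
      (∀ n g, φ (n + 1) (ι n g) = φ n g) ∧ ∀ h, ∃ n g, φ n g = h := by
  let f : ∀ i j, i ≤ j → G i →* G j := fun i j h =>
    Nat.leRec (motive := fun j _ => G i →* G j) (MonoidHom.id _) (fun k _ f => (ι k).comp f) h
  have hself : ∀ i, f i i le_rfl = MonoidHom.id _ := fun i => Nat.leRec_self _ _
  have hsucc : ∀ i j (h : i ≤ j), f i (j + 1) (h.trans j.le_succ) = (ι j).comp (f i j h) :=
    fun i j h => Nat.leRec_succ _ _ h
  have hinj : ∀ i j h, Function.Injective (f i j h) := fun i j h => by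
    induction j, h using Nat.le_induction with
    | base => rw [hself]; exact Function.injective_id
    | succ j h ih => rw [hsucc i j h]; exact (hι j).comp ih
  have hsys : DirectedSystem G (fun i j h => f i j h) :=
    { map_self := fun i x => by rw [hself]; rfl
      map_map := fun k j i hij hjk x => by
        induction k, hjk using Nat.le_induction with
        | base => rw [hself]; rfl
        | succ k h ih => rw [hsucc _ _ h, hsucc _ _ (hij.trans h), MonoidHom.comp_apply, ih]; rfl }
  refine ⟨DirectLimit G f, inferInstance, fun n =>
    { toFun := fun g => ⟦⟨n, g⟩⟧
      map_one' := (DirectLimit.one_def n).symm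
      map_mul' := fun a b => (DirectLimit.mul_def n a b).symm },
    fun n => DirectLimit.mk_injective f hinj n, fun n g => ?_, fun h => ?_⟩
  · have h1 := DirectLimit.eq_of_le (f := f) ⟨n, g⟩ (n + 1) n.le_succ
    have h2 : f n (n + 1) n.le_succ g = ι n g := by
      rw [hsucc n n le_rfl, hself]
      rfl
    rw [← h2]
    exact h1.symm
  · obtain ⟨n, g, rfl⟩ := DirectLimit.exists_eq_mk (f := f) h
    exact ⟨n, g, rfl⟩

/-- A group embeds in a group in which each of its nontrivial elements normally generates a
subgroup containing it. -/
theorem exists_normally_generating_embedding (G : Type u) [Group G] [Countable G] :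
    ∃ (L : Type u) (_ : Group L) (ι : G →* L), Countable L ∧ Nontrivial L ∧ Function.Injective ι ∧
      (∀ N : Subgroup L, N.Normal → ∀ g, g ≠ 1 → ι g ∈ N → ∀ c, ι c ∈ N) ∧
      (∀ C : (G : Type u) → [Group G] → Prop, IsTameClass C → C G → C L) ∧
      (IsOrderableGroup G → IsOrderableGroup L) := by
  obtain ⟨K, _, ι, _, _, hι, hcomm, hC, ho⟩ := exists_derived_embedding G
  obtain ⟨L, _, κ, hL, hκ, hN, hC', ho'⟩ := exists_wreath_embedding K
  refine ⟨L, inferInstance, κ.comp ι, hL, hκ.nontrivial, hκ.comp hι,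
    fun N hNn g hg hgN c => hN N hNn (ι g) (fun h => hg (hι (h.trans (map_one ι).symm))) hgN _
      (hcomm c), fun C hCt h => hC' C hCt (hC C hCt h), fun h => ho' (ho h)⟩

/-- A countable group together with its structure. -/
structure CountableGroup : Type (u + 1) where
  /-- The underlying type. -/
  carrier : Type u
  [group : Group carrier]
  [countable : Countable carrier]

attribute [instance] CountableGroup.group CountableGroup.countable

/-- The quantifier over classes comes after H, so a single H inherits all the properties of A
simultaneously. -/
theorem exists_simple_embedding (A : Type u) [Group A] [Countable A] :
    ∃ (H : Type u) (_ : Group H), Countable H ∧ IsSimpleGroup H ∧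
      (∃ f : A →* H, Function.Injective f) ∧
      (∀ C : (G : Type u) → [Group G] → Prop, IsTameClass C → C A → C H) ∧
      (IsOrderableGroup A → IsOrderableGroup H) := by
  have step : ∀ G : CountableGroup.{u}, ∃ (L : CountableGroup.{u}) (ι : G.carrier →* L.carrier),
      Nontrivial L.carrier ∧ Function.Injective ι ∧
      (∀ N : Subgroup L.carrier, N.Normal → ∀ g, g ≠ 1 → ι g ∈ N → ∀ c, ι c ∈ N) ∧
      (∀ C : (G : Type u) → [Group G] → Prop, IsTameClass C → C G.carrier → C L.carrier) ∧
      (IsOrderableGroup G.carrier → IsOrderableGroup L.carrier) := fun G => by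
    obtain ⟨L, _, ι, _, h⟩ := exists_normally_generating_embedding G.carrier
    exact ⟨⟨L⟩, ι, h⟩
  choose next ι hnt hι hnormal hC ho using step
  let G : ℕ → CountableGroup.{u} := fun n =>
    Nat.rec (motive := fun _ => CountableGroup.{u}) ⟨A⟩ (fun _ => next) n
  let ιG : ∀ n : ℕ, (G n).carrier →* (G (n + 1)).carrier := fun n => ι (G n)
  obtain ⟨H, _, φ, hφ, hφι, hsurj⟩ := exists_sequential_limit ιG fun n => hι (G n)
  have hmono : Monotone fun n => (φ n).range := monotone_nat_of_le_succ fun n => by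
    rintro _ ⟨g, rfl⟩
    exact ⟨_, hφι n g⟩
  have hne : (Set.range fun n => (φ n).range).Nonempty := Set.range_nonempty _
  have hdir : DirectedOn (· ≤ ·) (Set.range fun n => (φ n).range) :=
    directedOn_range.2 hmono.directed_le
  have hcov : ∀ h : H, ∃ K ∈ Set.range fun n => (φ n).range, h ∈ K := fun h => by
    obtain ⟨n, g, rfl⟩ := hsurj h
    exact ⟨_, ⟨n, rfl⟩, g, rfl⟩
  refine ⟨H, inferInstance, ?_, ?_, ⟨φ 0, hφ 0⟩, fun C hCt hA => ?_, fun hA => ?_⟩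
  · have : Function.Surjective fun x : Σ n, (G n).carrier => φ x.1 x.2 := fun h => by
      obtain ⟨n, g, hg⟩ := hsurj h
      exact ⟨⟨n, g⟩, hg⟩
    exact this.countable
  · have : Nontrivial (G 1).carrier := hnt (G 0)
    have : Nontrivial H := (hφ 1).nontrivial
    refine ⟨fun N hN => or_iff_not_imp_left.2 fun hbot => ?_⟩
    obtain ⟨h, hhN, hh⟩ := N.bot_or_exists_ne_one.resolve_left hbot
    obtain ⟨n, g, rfl⟩ := hsurj h
    refine eq_top_iff.2 fun x _ => ?_
    obtain ⟨m, y, rfl⟩ := hsurj x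
    obtain ⟨g', hg'⟩ := hmono (le_max_left n m) ⟨g, rfl⟩
    obtain ⟨y', hy'⟩ := hmono (le_max_right n m) ⟨y, rfl⟩
    rw [← hg'] at hhN hh
    rw [← hy', ← hφι]
    -- Both elements live at stage max n m; normal generation takes place one stage later.
    refine hnormal (G (max n m)) (N.comap (φ (max n m + 1))) inferInstance g' (fun h => hh ?_) ?_ y'
    · rw [h, map_one]
    · rw [Subgroup.mem_comap]
      exact (hφι _ g').symm ▸ hhN
  · refine hCt.of_directedOn _ hne hdir hcov ?_
    rintro _ ⟨n, rfl⟩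
    refine hCt.range _ (hφ n) ?_
    induction n with
    | zero => exact hA
    | succ n ih => exact hC (G n) C hCt ih
  · refine .of_directedOn _ hne hdir hcov ?_
    rintro _ ⟨n, rfl⟩
    refine .of_injective ((φ n).ofInjective (hφ n)).symm.toMonoidHom
      ((φ n).ofInjective (hφ n)).symm.injective ?_
    induction n with
    | zero => exact hA
    | succ n ih => exact ho (G n) ih

/-- Orderability is a genuine exception: the Klein bottle group is an extension of ℤ by ℤ and is not
orderable. -/
theorem GroupProperty.isTameClass_holds (p : GroupProperty) (hp : p ≠ .orderable) :
    IsTameClass (fun (G : Type u) [Group G] => p.Holds G) := by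
  cases p with
  | amenable => exact isTameClass_isAmenableGroup
  | elementaryAmenable => exact isTameClass_isElementaryAmenable
  | subexponentiallyAmenable => exact isTameClass_isSubexponentiallyAmenable
  | torsionFree => exact isTameClass_isTorsionFreeGroup
  | locallyIndicable => exact isTameClass_isLocallyIndicable
  | orderable => exact absurd rfl hp
  | rightOrderable => exact isTameClass_isRightOrderableGroup

end SimpleLimit

theorem mainTheorem1 (P : Set GroupProperty) (A : Type u) [Group A] [Countable A]
    (hA : ∀ p ∈ P, p.Holds A) :
    ∃ (H : Type u) (_ : Group H), Countable H ∧ IsSimpleGroup H ∧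
      (∃ f : A →* H, Function.Injective f) ∧ ∀ p ∈ P, p.Holds H := by
  obtain ⟨H, _, hc, hs, hf, hC, ho⟩ := exists_simple_embedding A
  refine ⟨H, inferInstance, hc, hs, hf, fun p hp => ?_⟩
  by_cases h : p = .orderable
  · subst h
    exact ho (hA _ hp)
  · exact hC _ (p.isTameClass_holds h) (hA p hp)
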